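/- Let $G$ be a finite group, $A,B\subseteq G$ subgroups, $\pi\in Z^4(G,\mathrm U(1))$ a normalised $4$-cocycle, and $\lambda\in C^3(A,\mathrm U(1))$, $\mu\in C^3(B,\mathrm U(1))$ normalised cochains with $d^{(3)}\lambda=\pi^{-1}|_A$ and $d^{(3)}\mu=\pi^{-1}|_B$. Write $x^y=y^{-1}xy$ and, for $3$-cochains $f$ and $4$-cochains $\pi$, $$\mathsf T_x(f)(y_1,y_2)=\frac{f(x,y_1,y_2)\,f(y_1,y_2,x^{y_1y_2})}{f(y_1,x^{y_1},y_2)},\qquad \mathsf T_x(\pi)(y_1,y_2,y_3)=\frac{\pi(y_1,x^{y_1},y_2,y_3)\,\pi(y_1,y_2,y_3,x^{y_1y_2y_3})}{\pi(x,y_1,y_2,y_3)\,\pi(y_1,y_2,x^{y_1y_2},y_3)} .$$ Let $\Lambda(G_{AB})$ be the groupoid whose objects are the triples $\mathfrak g=(g,a_2,b_2)\in G\times A\times B$ with $b_2=g^{-1}a_2g$ and whose morphisms are $(\mathfrak g,a,b):\mathfrak g\to a^{-1}\mathfrak g b:=(a^{-1}gb,a_2^{a},b_2^{b})$ for $(a,b)\in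 A\times B$, composed by multiplication in $A\times B$. Put $$\vartheta_{\mathfrak g}(a,a'|b,b')=\frac{\mathsf T_{b_2}(\mu)(b,b')}{\mathsf T_{a_2}(\lambda)(a,a')}\cdot\frac{\mathsf T_{a_2}(\pi)(a,a',a'^{-1}a^{-1}gbb')\,\mathsf T_{a_2}(\pi)(g,b,b')}{\mathsf T_{a_2}(\pi)(a,a^{-1}gb,b')} .$$ The twisted relative groupoid algebra $\mathcal A=\mathbb C[\Lambda(G_{AB})]^{\alpha}_{\phi\psi}$ (with $\alpha=\mathsf T(\pi)$, $\phi=\mathsf T(\lambda)$, $\psi=\mathsf T(\mu)$) has as basis the morphisms $|\mathfrak g,a,b\rangle$ and product $|\mathfrak g,a,b\rangle\star|\mathfrak g',a',b'\rangle=\delta_{\mathfrak g',a^{-1}\mathfrak gb}\,\vartheta_{\mathfrak g}(a,a'|b,b')\,|\mathfrak g,aa',bb'\rangle$; it is a unital associative algebra with unit $\sum_{\mathfrak g}|\mathfrak g,1,1\rangle$. In each orbit $\mathcal O$ of $A\times B$ on objects choose a representative $\mathfrak o_1$ and, for each $\mathfrak o_i\in\mathcal O$, a pair $(p_i,q_i)\in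 A\times B$ with $p_i^{-1}\mathfrak o_iq_i=\mathfrak o_1$ and $(p_1,q_1)=(1,1)$. Let $Z_{\mathcal O}=\{(a,b)\in A\times B: a^{-1}\mathfrak o_1b=\mathfrak o_1\}$. Choose, in each equivalence class $R$ of simple unitary $\vartheta_{\mathfrak o_1}$-projective representations of $Z_{\mathcal O}$ (that is, $\mathcal D(z)\mathcal D(w)=\vartheta_{\mathfrak o_1}(z,w)\mathcal D(zw)$), a representative $\mathcal D^R$ by unitary matrices on $V_R=\mathbb C^{\dim V_R}$. For $\rho=(\mathcal O,R)$ let $d_\rho=|\mathcal O|\dim V_R$ and define $d_\rho\times d_\rho$ matrices, with rows and columns indexed by pairs $[im]$, by $$\mathcal D^{\rho}_{[im][jn]}(|\mathfrak g,a,b\rangle)=\delta_{\mathfrak g,\mathfrak o_i}\,\delta_{a^{-1}\mathfrak gb,\mathfrak o_j}\,\frac{\vartheta_{\mathfrak o_1}(p_i^{-1},a|q_i^{-1},b)}{\vartheta_{\mathfrak o_1}(p_i^{-1}ap_j,p_j^{-1}|q_i^{-1}bq_j,q_j^{-1})}\,\mathcal D^R_{mn}(p_i^{-1}ap_j,q_i^{-1}bq_j).$$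 Then the following hold. 1. The conjugate-linear extension of $|\mathfrak g,a,b\rangle^*=\vartheta_{\mathfrak g}(a,a^{-1}|b,b^{-1})^{-1}\,|a^{-1}\mathfrak gb,a^{-1},b^{-1}\rangle$ makes $\mathcal A$ a $*$-algebra, and $\mathcal A$ is semisimple. 2. Each $\mathcal D^\rho$ extends linearly to a unital algebra homomorphism $\mathcal A\to\mathrm{Mat}_{d_\rho}(\mathbb C)$ with $\mathcal D^\rho(x^*)=\mathcal D^\rho(x)^\dagger$. 3. The simple $\mathcal A$-modules are labelled by the pairs $\rho=(\mathcal O,R)$: for each $\rho$ the right module of row vectors $v\triangleright x=v\,\mathcal D^\rho(x)$ is simple, different labels give non-isomorphic modules, and every simple right module is isomorphic to exactly one of these. The same holds for left modules, with column vectors and $x\cdot v=\mathcal D^\rho(x)v$. 4. (Orthogonality) For all labels $\rho,\rho'$ and all indices $I,J$ of $\mathcal D^\rho$ and $I',J'$ of $\mathcal D^{\rho'}$, $$\frac1{|A||B|}\sum_{(\mathfrak g,a,b)}\overline{\mathcal D^{\rho}_{IJ}(|\mathfrak g,a,b\rangle)}\,\mathcal D^{\rho'}_{I'J'}(|\mathfrak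 g,a,b\rangle)=\frac{\delta_{\rho,\rho'}}{d_\rho}\,\delta_{I,I'}\,\delta_{J,J'} .$$ 5. (Completeness) There are finitely many labels, and for all morphisms $(\mathfrak g,a,b)$, $(\mathfrak g',a',b')$, $$\frac1{|A||B|}\sum_\rho\sum_{I,J}d_\rho\,\mathcal D^\rho_{IJ}(|\mathfrak g,a,b\rangle)\,\overline{\mathcal D^\rho_{IJ}(|\mathfrak g',a',b'\rangle)}=\delta_{\mathfrak g,\mathfrak g'}\,\delta_{a,a'}\,\delta_{b,b'} .$$ -/

import Mathlib

open scoped Matrix ComplexConjugate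

noncomputable section

namespace RelGpd

/-! ### Group cochains (multiplicative, trivial coefficients) and their loop transgression -/

/-- Coboundary of a group `3`-cochain with trivial coefficients in `M`; below `M = U(1)`. -/
def d3 {H M : Type*} [Group H] [CommGroup M] (f : H → H → H → M) (a b c d : H) : M :=
  f b c d * f a (b * c) d * f a b c / (f (a * b) c d * f a b (c * d))

/-- Coboundary of a group `4`-cochain. -/
def d4 {H M : Type*} [Group H] [CommGroup M] (f : H → H → H → H → M) (a b c d e : H) : M :=
  f b c d e * f a (b * c) d e * f a b c (d * e) /
    (f (a * b) c d e * f a b (c * d) e * f a b c d)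

/-- A `3`-cochain is normalised if it is `1` as soon as one argument is the identity. -/
def Normalised3 {H M : Type*} [Group H] [CommGroup M] (f : H → H → H → M) : Prop :=
  ∀ a b : H, f 1 a b = 1 ∧ f a 1 b = 1 ∧ f a b 1 = 1

/-- A `4`-cochain is normalised if it is `1` as soon as one argument is the identity. -/
def Normalised4 {H M : Type*} [Group H] [CommGroup M] (f : H → H → H → H → M) : Prop :=
  ∀ a b c : H, f 1 a b c = 1 ∧ f a 1 b c = 1 ∧ f a b 1 c = 1 ∧ f a b c 1 = 1

/-- `x ^ y = y⁻¹ x y`. -/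
def cj {H : Type*} [Group H] (x y : H) : H := y⁻¹ * x * y

/-- Transgression of a `3`-cochain of `H`: the `2`-cochain `T_x(f)(y₁, y₂)` of the loop groupoid
`ΛH`, evaluated on the composable morphisms `x --y₁--> x^y₁ --y₂--> x^(y₁y₂)`. -/
def T3 {H M : Type*} [Group H] [CommGroup M] (f : H → H → H → M) (x y₁ y₂ : H) : M :=
  f x y₁ y₂ * f y₁ y₂ (cj x (y₁ * y₂)) / f y₁ (cj x y₁) y₂

/-- Transgression of a `4`-cochain of `H`: the `3`-cochain `T_x(f)(y₁, y₂, y₃)` of `ΛH`, evaluated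
on the composable morphisms starting at `x` with labels `y₁, y₂, y₃`. -/
def T4 {H M : Type*} [Group H] [CommGroup M] (f : H → H → H → H → M) (x y₁ y₂ y₃ : H) : M :=
  f y₁ (cj x y₁) y₂ y₃ * f y₁ y₂ y₃ (cj x (y₁ * y₂ * y₃)) /
    (f x y₁ y₂ y₃ * f y₁ y₂ (cj x (y₁ * y₂)) y₃)

theorem cj_mul {H : Type*} [Group H] (x y z : H) : cj (cj x y) z = cj x (y * z) := by
  simp [cj, mul_assoc]

theorem mul_cj {H : Type*} [Group H] (x y : H) : y * cj x y = x * y := by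
  simp [cj, mul_assoc]

theorem mul_cj' {H : Type*} [Group H] (x y z : H) : z * cj x (y * z) = cj x y * z := by
  simp [cj, mul_assoc]

theorem mul_cj2 {H : Type*} [Group H] (x a b z : H) :
    z * cj x (a * (b * z)) = cj x (a * b) * z := by
  simp [cj, mul_assoc]

theorem mul_cj3 {H : Type*} [Group H] (x a b c z : H) :
    z * cj x (a * (b * (c * z))) = cj x (a * (b * c)) * z := by
  simp [cj, mul_assoc]

/-- The loop groupoid coboundary of the transgression of `f` is the transgression of `d f`. -/
theorem d_T3 {H M : Type*} [Group H] [CommGroup M] (f : H → H → H → M) (x y₁ y₂ y₃ : H) :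
    T3 f (cj x y₁) y₂ y₃ * T3 f x y₁ (y₂ * y₃) / (T3 f x (y₁ * y₂) y₃ * T3 f x y₁ y₂)
      = T4 (d3 f) x y₁ y₂ y₃ := by
  apply Additive.ofMul.injective
  simp only [T3, T4, d3, ofMul_mul, ofMul_div, cj_mul, mul_cj, mul_cj', mul_cj2,
    mul_assoc]
  abel

/-- The transgression of a `4`-cocycle is a `3`-cocycle of the loop groupoid. -/
theorem T4_cocycle {H M : Type*} [Group H] [CommGroup M] (f : H → H → H → H → M)
    (hf : ∀ a b c d e, d4 f a b c d e = 1) (x y₁ y₂ y₃ y₄ : H) :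
    T4 f (cj x y₁) y₂ y₃ y₄ * T4 f x y₁ (y₂ * y₃) y₄ * T4 f x y₁ y₂ y₃ =
      T4 f x (y₁ * y₂) y₃ y₄ * T4 f x y₁ y₂ (y₃ * y₄) := by
  have h1 := congrArg Additive.ofMul (hf x y₁ y₂ y₃ y₄)
  have h2 := congrArg Additive.ofMul (hf y₁ (cj x y₁) y₂ y₃ y₄)
  have h3 := congrArg Additive.ofMul (hf y₁ y₂ (cj x (y₁ * y₂)) y₃ y₄)
  have h4 := congrArg Additive.ofMul (hf y₁ y₂ y₃ (cj x (y₁ * y₂ * y₃)) y₄)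
  have h5 := congrArg Additive.ofMul (hf y₁ y₂ y₃ y₄ (cj x (y₁ * y₂ * y₃ * y₄)))
  apply Additive.ofMul.injective
  simp only [T4, d4, ofMul_mul, ofMul_div, ofMul_one, cj_mul, mul_cj, mul_cj', mul_cj2, mul_cj3,
    mul_assoc]
    at h1 h2 h3 h4 h5 ⊢
  rw [← sub_eq_zero]
  have key := congrArg₂ (· + ·) (congrArg₂ (· - ·) h1 h2)
    (congrArg₂ (· + ·) (congrArg₂ (· - ·) h3 h4) h5)
  simp only [sub_zero, add_zero] at key
  refine Eq.trans ?_ key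
  set_option maxHeartbeats 2000000 in abel


/-- Coboundary of the `α`-part of the relative groupoid `2`-cocycle. -/
theorem d_alpha_part {H M : Type*} [Group H] [CommGroup M] (F : H → H → H → H → M)
    (hF : ∀ x a b c d, F (cj x a) b c d * F x a (b * c) d * F x a b c =
      F x (a * b) c d * F x a b (c * d)) (x g a₁ a₂ a₃ b₁ b₂ b₃ : H)
    (A : H → H → H → H → H → H → M)
    (hA : ∀ x g a b a' b', A x g a b a' b' =
      F x a a' (a'⁻¹ * a⁻¹ * g * b * b') * F x g b b' / F x a (a⁻¹ * g * b) b') :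
    A (cj x a₁) (a₁⁻¹ * g * b₁) a₂ b₂ a₃ b₃ * A x g a₁ b₁ (a₂ * a₃) (b₂ * b₃) /
      (A x g (a₁ * a₂) (b₁ * b₂) a₃ b₃ * A x g a₁ b₁ a₂ b₂) =
      F (cj x g) b₁ b₂ b₃ / F x a₁ a₂ a₃ := by
  have h1 := congrArg Additive.ofMul (hF x a₁ a₂ a₃ (a₃⁻¹ * a₂⁻¹ * a₁⁻¹ * g * b₁ * b₂ * b₃))
  have h2 := congrArg Additive.ofMul (hF x a₁ a₂ (a₂⁻¹ * a₁⁻¹ * g * b₁ * b₂) b₃)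
  have h3 := congrArg Additive.ofMul (hF x a₁ (a₁⁻¹ * g * b₁) b₂ b₃)
  have h4 := congrArg Additive.ofMul (hF x g b₁ b₂ b₃)
  apply Additive.ofMul.injective
  simp only [hA, ofMul_mul, ofMul_div, mul_inv_rev, mul_assoc, mul_inv_cancel_left]
    at h1 h2 h3 h4 ⊢
  rw [← sub_eq_zero] at h1 h2 h3 h4 ⊢
  have key := congrArg₂ (· + ·) (congrArg₂ (· - ·) h1 h2) (congrArg₂ (· - ·) h3 h4)
  simp only [sub_zero, add_zero] at key
  refine Eq.trans ?_ key
  set_option maxHeartbeats 2000000 in abel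

theorem combine_cocycle {M : Type*} [CommGroup M] {a₁ a₂ a₃ a₄ l₁ l₂ l₃ l₄ m₁ m₂ m₃ m₄ p q : M}
    (ha : a₁ * a₂ / (a₃ * a₄) = p / q) (hl : l₁ * l₂ / (l₃ * l₄) = q⁻¹)
    (hm : m₁ * m₂ / (m₃ * m₄) = p⁻¹) :
    m₄ / l₄ * a₄ * (m₃ / l₃ * a₃) = m₁ / l₁ * a₁ * (m₂ / l₂ * a₂) := by
  have h : a₁ * a₂ / (a₃ * a₄) * (m₁ * m₂ / (m₃ * m₄)) / (l₁ * l₂ / (l₃ * l₄)) = 1 := by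
    rw [ha, hl, hm, div_mul_eq_mul_div, mul_inv_cancel, one_div, div_self']
  apply Additive.ofMul.injective
  have h' := congrArg Additive.ofMul h
  simp only [ofMul_mul, ofMul_div, ofMul_one] at h' ⊢
  rw [eq_comm, ← sub_eq_zero]
  refine Eq.trans ?_ h'
  abel

theorem coe_cj {G : Type*} [Group G] {S : Subgroup G} (x y : S) :
    ((cj x y : S) : G) = cj (x : G) (y : G) := by
  simp [cj]

/-! ### Projective representations, and modules given by matrix representations -/

/-- A simple unitary `c`-projective representation of a group `Z`, on `ℂ^dim`, in matrix form. -/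
structure SimpleProjRep (Z : Type*) [Group Z] (c : Z → Z → Circle) where
  dim : ℕ
  dim_pos : 0 < dim
  mat : Z → Matrix (Fin dim) (Fin dim) ℂ
  unitary : ∀ z, mat z ∈ Matrix.unitaryGroup (Fin dim) ℂ
  mat_mul : ∀ z w, mat z * mat w = (c z w : ℂ) • mat (z * w)
  simple : ∀ W : Submodule ℂ (Fin dim → ℂ), (∀ z, ∀ w ∈ W, mat z *ᵥ w ∈ W) → W = ⊥ ∨ W = ⊤

/-- Equivalence of projective representations: existence of an invertible intertwiner. -/
def SimpleProjRep.equivalence {Z : Type*} [Group Z] (c : Z → Z → Circle) :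
    Setoid (SimpleProjRep Z c) where
  r R S := ∃ e : (Fin R.dim → ℂ) ≃ₗ[ℂ] (Fin S.dim → ℂ),
    ∀ z v, e (R.mat z *ᵥ v) = S.mat z *ᵥ e v
  iseqv :=
    { refl := fun R => ⟨LinearEquiv.refl ℂ _, fun _ _ => rfl⟩
      symm := fun ⟨e, he⟩ => ⟨e.symm, fun z v => by
        apply e.injective
        rw [he, e.apply_symm_apply, e.apply_symm_apply]⟩
      trans := fun ⟨e, he⟩ ⟨f, hf⟩ => ⟨e.trans f, fun z v => by
        simp only [LinearEquiv.trans_apply, he, hf]⟩ }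

/-- Equivalence classes of simple unitary `c`-projective representations of `Z`. -/
def IrrClass (Z : Type*) [Group Z] (c : Z → Z → Circle) : Type _ :=
  Quotient (SimpleProjRep.equivalence (Z := Z) c)

/-- The right module of row vectors of a matrix representation `Φ`: `v ▷ x = v Φ(x)`. -/
def RowModule {R n : Type*} [Ring R] [Algebra ℂ R] [Fintype n] [DecidableEq n]
    (_Φ : R →ₐ[ℂ] Matrix n n ℂ) : Type _ := n → ℂ

/-- The left module of column vectors of a matrix representation `Φ`: `x • v = Φ(x) v`. -/
def ColModule {R n : Type*} [Ring R] [Algebra ℂ R] [Fintype n] [DecidableEq n]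
    (_Φ : R →ₐ[ℂ] Matrix n n ℂ) : Type _ := n → ℂ

section

variable {R n : Type*} [Ring R] [Algebra ℂ R] [Fintype n] [DecidableEq n]
  (Φ : R →ₐ[ℂ] Matrix n n ℂ)

instance : AddCommGroup (RowModule Φ) := inferInstanceAs (AddCommGroup (n → ℂ))

instance : AddCommGroup (ColModule Φ) := inferInstanceAs (AddCommGroup (n → ℂ))

instance : Module Rᵐᵒᵖ (RowModule Φ) where
  smul x v := Matrix.vecMul v (Φ x.unop)
  one_smul v := (congrArg (Matrix.vecMul v) (map_one Φ)).trans (Matrix.vecMul_one v)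
  mul_smul x y v := (congrArg (Matrix.vecMul v) (map_mul Φ y.unop x.unop)).trans
    (Matrix.vecMul_vecMul v _ _).symm
  smul_zero _ := Matrix.zero_vecMul _
  smul_add _ v w := Matrix.add_vecMul _ v w
  add_smul x y v := (congrArg (Matrix.vecMul v) (map_add Φ x.unop y.unop)).trans
    (Matrix.vecMul_add _ _ v)
  zero_smul v := (congrArg (Matrix.vecMul v) (map_zero Φ)).trans (Matrix.vecMul_zero v)

instance : Module R (ColModule Φ) where
  smul x v := Matrix.mulVec (Φ x) v
  one_smul v := (congrArg (fun m => Matrix.mulVec m v) (map_one Φ)).trans (Matrix.one_mulVec v)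
  mul_smul x y v := (congrArg (fun m => Matrix.mulVec m v) (map_mul Φ x y)).trans
    (Matrix.mulVec_mulVec v _ _).symm
  smul_zero _ := Matrix.mulVec_zero _
  smul_add _ v w := Matrix.mulVec_add _ v w
  add_smul x y v := (congrArg (fun m => Matrix.mulVec m v) (map_add Φ x y)).trans
    (Matrix.add_mulVec _ _ v)
  zero_smul v := (congrArg (fun m => Matrix.mulVec m v) (map_zero Φ)).trans (Matrix.zero_mulVec v)

end

/-! ### Input data and the relative groupoid `Λ(G_AB)` -/

/-- Input data: a normalised `4`-cocycle `pi` of `G` and two gapped boundaries, i.e. subgroups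
`A`, `B` with normalised `3`-cochains `lam`, `mu` satisfying `d lam = pi⁻¹|_A`, `d mu = pi⁻¹|_B`. -/
structure BoundaryData (G : Type*) [Group G] where
  pi : G → G → G → G → Circle
  pi_normalised : Normalised4 pi
  pi_cocycle : ∀ a b c d e, d4 pi a b c d e = 1
  A : Subgroup G
  lam : A → A → A → Circle
  lam_normalised : Normalised3 lam
  d_lam : ∀ a b c d : A, d3 lam a b c d = (pi a b c d)⁻¹
  B : Subgroup G
  mu : B → B → B → Circle
  mu_normalised : Normalised3 mu
  d_mu : ∀ a b c d : B, d3 mu a b c d = (pi a b c d)⁻¹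

namespace BoundaryData

variable {G : Type*} [Group G] (D : BoundaryData G)

/-- The group `A × B`. -/
abbrev K : Type _ := D.A × D.B

/-- Objects of `Λ(G_AB)`: the morphisms `a --g--> b = g⁻¹ a g` of the loop groupoid `ΛG` whose
source lies in `A` and whose target lies in `B`. -/
@[ext] structure Obj where
  g : G
  a : D.A
  b : D.B
  flat : (b : G) = cj (a : G) g

variable {D}

/-- A morphism of `Λ(G_AB)` with source `x` is given by `k = (a₁, b₁) ∈ A × B`; this is its target,
`a₁⁻¹ g b₁ : a₁⁻¹ a a₁ → b₁⁻¹ b b₁`. -/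
def Obj.act (x : D.Obj) (k : D.K) : D.Obj where
  g := (k.1 : G)⁻¹ * x.g * k.2
  a := cj x.a k.1
  b := cj x.b k.2
  flat := by simp [x.flat, cj, mul_assoc]

@[simp] theorem Obj.act_one (x : D.Obj) : x.act 1 = x := by
  ext <;> simp [Obj.act, cj]

theorem Obj.act_mul (x : D.Obj) (k l : D.K) : x.act (k * l) = (x.act k).act l := by
  ext <;> simp [Obj.act, cj, mul_assoc]

variable (D)

/-- The `2`-cocycle `ϑ_x(a₁, a₁' | b₁, b₁')` of `Λ(G_AB)` on the composable pair
`x --k--> x.act k --l--> x.act (k * l)` with `k = (a₁, b₁)`, `l = (a₁', b₁')`: the formula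
`ψ(b₁,b₁') / φ(a₁,a₁') · α(a₁,a₁',a₁'⁻¹a₁⁻¹ g b₁b₁') α(g,b₁,b₁') / α(a₁,a₁⁻¹ g b₁,b₁')`
with `α`, `φ`, `ψ` the transgressions of `pi`, `lam`, `mu`. -/
def theta (x : D.Obj) (k l : D.K) : Circle :=
  T3 D.mu x.b k.2 l.2 / T3 D.lam x.a k.1 l.1 *
    (T4 D.pi x.a k.1 l.1 ((l.1 : G)⁻¹ * (k.1 : G)⁻¹ * x.g * k.2 * l.2) *
        T4 D.pi x.a x.g k.2 l.2 /
      T4 D.pi x.a k.1 ((k.1 : G)⁻¹ * x.g * k.2) l.2)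

theorem theta_one_left (x : D.Obj) (k : D.K) : D.theta x 1 k = 1 := by
  have h := D.pi_normalised
  have hl := D.lam_normalised
  have hm := D.mu_normalised
  simp only [Normalised3, Normalised4] at h hl hm
  simp [theta, T3, T4, h, hl, hm, cj, mul_assoc]

theorem theta_one_right (x : D.Obj) (k : D.K) : D.theta x k 1 = 1 := by
  have h := D.pi_normalised
  have hl := D.lam_normalised
  have hm := D.mu_normalised
  simp only [Normalised3, Normalised4] at h hl hm
  simp [theta, T3, T4, h, hl, hm, cj, mul_assoc]

theorem d_T3_lam (x a b c : D.A) :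
    T3 D.lam (cj x a) b c * T3 D.lam x a (b * c) / (T3 D.lam x (a * b) c * T3 D.lam x a b)
      = (T4 D.pi x a b c)⁻¹ := by
  rw [d_T3]
  simp only [T4, D.d_lam, coe_cj, Subgroup.coe_mul]
  simp only [div_eq_mul_inv, mul_inv_rev, inv_inv, mul_comm]

theorem d_T3_mu (x a b c : D.B) :
    T3 D.mu (cj x a) b c * T3 D.mu x a (b * c) / (T3 D.mu x (a * b) c * T3 D.mu x a b)
      = (T4 D.pi x a b c)⁻¹ := by
  rw [d_T3]
  simp only [T4, D.d_mu, coe_cj, Subgroup.coe_mul]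
  simp only [div_eq_mul_inv, mul_inv_rev, inv_inv, mul_comm]

theorem theta_cocycle (x : D.Obj) (k l m : D.K) :
    D.theta x k l * D.theta x (k * l) m = D.theta (x.act k) l m * D.theta x k (l * m) := by
  have hA := d_alpha_part (T4 D.pi) (T4_cocycle D.pi D.pi_cocycle) x.a x.g k.1 l.1 m.1 k.2 l.2 m.2
    _ (fun _ _ _ _ _ _ => rfl)
  have hl := d_T3_lam D x.a k.1 l.1 m.1
  have hm := d_T3_mu D x.b k.2 l.2 m.2
  rw [x.flat] at hm
  have key := combine_cocycle hA hl hm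
  simpa only [theta, Obj.act, Prod.fst_mul, Prod.snd_mul, Subgroup.coe_mul, coe_cj,
    mul_inv_rev, mul_assoc] using key

/-! ### Orbits, stabilisers, and the representation matrices -/

/-- Two objects are equivalent if there is a morphism between them. -/
def orbitRel : Setoid D.Obj where
  r x y := ∃ k, x.act k = y
  iseqv :=
    { refl := fun x => ⟨1, x.act_one⟩
      symm := fun {x y} ⟨k, h⟩ => ⟨k⁻¹, by rw [← h, ← Obj.act_mul, mul_inv_cancel, Obj.act_one]⟩
      trans := fun {x y z} ⟨k, h⟩ ⟨l, h'⟩ => ⟨k * l, by rw [Obj.act_mul, h, h']⟩ }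

/-- The orbits of `A × B` on the objects of `Λ(G_AB)`. -/
def Orbit : Type _ := Quotient D.orbitRel

variable {D} in
/-- The orbit of an object. -/
def Obj.orbit (x : D.Obj) : D.Orbit := Quotient.mk D.orbitRel x

/-- The stabiliser of an object, as a subgroup of `A × B`. -/
def stab (x : D.Obj) : Subgroup D.K where
  carrier := {k | x.act k = x}
  one_mem' := x.act_one
  mul_mem' := fun {k l} hk hl => by
    change x.act k = x at hk
    change x.act l = x at hl
    change x.act (k * l) = x
    rw [Obj.act_mul, hk, hl]
  inv_mem' := fun {k} hk => by
    change x.act k = x at hk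
    change x.act k⁻¹ = x
    conv_lhs => rw [← hk]
    rw [← Obj.act_mul, mul_inv_cancel, Obj.act_one]

/-- The restriction of `ϑ_x` to the stabiliser of `x`. -/
def stabCocycle (x : D.Obj) (z w : D.stab x) : Circle := D.theta x z w

/-- The choices made for the representation matrices: in every orbit a representative `𝔬₁`, for
every object `x` of the orbit a morphism `(𝔭, 𝔮) : x ⟶ 𝔬₁`, which is the identity for `x = 𝔬₁`,
and a representative of every class of simple unitary `ϑ_𝔬₁`-projective representations of the
stabiliser of `𝔬₁`. -/
structure Frame where
  base : D.Orbit → D.Obj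
  orbit_base : ∀ O, (base O).orbit = O
  conn : D.Obj → D.K
  act_conn : ∀ x : D.Obj, x.act (conn x) = base x.orbit
  conn_base : ∀ O, conn (base O) = 1
  rep : ∀ O, IrrClass (D.stab (base O)) (D.stabCocycle (base O)) →
    SimpleProjRep (D.stab (base O)) (D.stabCocycle (base O))
  rep_mem : ∀ O R, (Quotient.mk _ (rep O R) :
    IrrClass (D.stab (base O)) (D.stabCocycle (base O))) = R

open Classical in
instance : Nonempty D.Frame := by
  have h : ∀ x : D.Obj, ∃ k, x.act k = Quotient.out x.orbit := fun x =>
    D.orbitRel.symm (Quotient.mk_out (s := D.orbitRel) x)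
  choose p hp using h
  exact ⟨{
    base := Quotient.out
    orbit_base := Quotient.out_eq
    conn := fun x => if x = Quotient.out x.orbit then 1 else p x
    act_conn := fun x => by
      split_ifs with hx
      · rw [Obj.act_one, ← hx]
      · exact hp x
    conn_base := fun O => by
      have : (Quotient.out O : D.Obj).orbit = O := Quotient.out_eq O
      rw [this, if_pos rfl]
    rep := fun O R => Quotient.out R
    rep_mem := fun O R => Quotient.out_eq R }⟩

namespace Frame

variable {D} (F : D.Frame)

/-- The labels `ρ = (O, R)`. -/
def Label : Type _ :=
  Σ O : D.Orbit, IrrClass (D.stab (F.base O)) (D.stabCocycle (F.base O))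

variable {F}

/-- The representative `𝔬₁` of the orbit of a label. -/
def Label.base (ρ : F.Label) : D.Obj := F.base ρ.1

/-- The projective representation of the stabiliser of `𝔬₁` chosen for a label. -/
def Label.rep (ρ : F.Label) :
    SimpleProjRep (D.stab ρ.base) (D.stabCocycle ρ.base) := F.rep ρ.1 ρ.2

/-- The index set of pairs `[i m]`, with `i` an element `𝔬ᵢ` of the orbit and `m` an index of the
projective representation. -/
def Label.Idx (ρ : F.Label) : Type _ := {x : D.Obj // x.orbit = ρ.1} × Fin ρ.rep.dim

/-- `d_ρ = |O| dim V_R`. -/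
def Label.dim (ρ : F.Label) : ℕ := Nat.card {x : D.Obj // x.orbit = ρ.1} * ρ.rep.dim

theorem mem_stab {O : D.Orbit} {x y : D.Obj} (hx : x.orbit = O) (hy : y.orbit = O) {k : D.K}
    (h : x.act k = y) : (F.conn x)⁻¹ * k * F.conn y ∈ D.stab (F.base O) := by
  change (F.base O).act _ = F.base O
  have hx' := F.act_conn x
  have hy' := F.act_conn y
  rw [hx] at hx'
  rw [hy] at hy'
  rw [← hx', Obj.act_mul, Obj.act_mul, ← Obj.act_mul x, mul_inv_cancel, Obj.act_one, h, hy', hx']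

open Classical in
/-- The matrix of the basis element `|x, k⟩` in the representation labelled by `ρ = (O, R)`, where
`(𝔭ᵢ, 𝔮ᵢ) = F.conn 𝔬ᵢ`. -/
def Label.mat (ρ : F.Label) (x : D.Obj) (k : D.K) : Matrix ρ.Idx ρ.Idx ℂ := fun I J =>
  if h : x = I.1 ∧ x.act k = J.1 then
    (D.theta ρ.base (F.conn I.1)⁻¹ k : ℂ) /
        (D.theta ρ.base ((F.conn I.1)⁻¹ * k * F.conn J.1) (F.conn J.1)⁻¹ : ℂ) *
      ρ.rep.mat ⟨(F.conn I.1)⁻¹ * k * F.conn J.1,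
        mem_stab I.1.2 J.1.2 (h.1 ▸ h.2)⟩ I.2 J.2
  else 0

end Frame

/-! ### The twisted relative groupoid algebra -/

/-- The underlying vector space of the twisted relative groupoid algebra, with basis the morphisms
`(x, k) : x ⟶ x.act k` of `Λ(G_AB)`. -/
def Alg : Type _ := (D.Obj × D.K) →₀ ℂ

instance : AddCommGroup D.Alg := inferInstanceAs (AddCommGroup ((D.Obj × D.K) →₀ ℂ))

instance : Module ℂ D.Alg := inferInstanceAs (Module ℂ ((D.Obj × D.K) →₀ ℂ))

/-- The basis element of the morphism `k : x ⟶ x.act k`. -/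
def ket (x : D.Obj) (k : D.K) : D.Alg := Finsupp.single (x, k) (1 : ℂ)

open Classical in
/-- The product of two basis elements. -/
def ketMul (u v : D.Obj × D.K) : D.Alg :=
  if v.1 = u.1.act u.2 then (D.theta u.1 u.2 v.2 : ℂ) • D.ket u.1 (u.2 * v.2) else 0

/-- Bilinear extension of a function of basis elements. -/
def extend {V : Type*} [AddCommGroup V] [Module ℂ V] (f : D.Obj × D.K → V) : D.Alg →ₗ[ℂ] V :=
  Finsupp.linearCombination ℂ f

theorem extend_ket {V : Type*} [AddCommGroup V] [Module ℂ V] (f : D.Obj × D.K → V) (x : D.Obj)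
    (k : D.K) : D.extend f (D.ket x k) = f (x, k) := by
  exact (Finsupp.linearCombination_single ℂ (1 : ℂ) (x, k)).trans (one_smul ℂ _)

theorem hom_ext {V : Type*} [AddCommGroup V] [Module ℂ V] {f g : D.Alg →ₗ[ℂ] V}
    (h : ∀ x k, f (D.ket x k) = g (D.ket x k)) : f = g :=
  Finsupp.lhom_ext' fun u => LinearMap.ext_ring (h u.1 u.2)

/-- The product `x ⋆ y` as a bilinear map. -/
def mulLin : D.Alg →ₗ[ℂ] D.Alg →ₗ[ℂ] D.Alg := D.extend fun u => D.extend fun v => D.ketMul u v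

instance : Mul D.Alg := ⟨fun x y => D.mulLin x y⟩

theorem mul_def (x y : D.Alg) : x * y = D.mulLin x y := rfl

open Classical in
theorem ket_mul_ket (x y : D.Obj) (k l : D.K) :
    D.ket x k * D.ket y l =
      if y = x.act k then (D.theta x k l : ℂ) • D.ket x (k * l) else 0 := by
  simp [mul_def, mulLin, extend_ket, ketMul]

theorem alg_mul_assoc (x y z : D.Alg) : x * y * z = x * (y * z) := by
  have h1 : ∀ (a b : D.Obj) (k l : D.K) (z : D.Alg),
      D.mulLin (D.mulLin (D.ket a k) (D.ket b l)) z =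
        D.mulLin (D.ket a k) (D.mulLin (D.ket b l) z) := by
    intro a b k l
    refine LinearMap.congr_fun (f := D.mulLin (D.mulLin (D.ket a k) (D.ket b l)))
      (g := (D.mulLin (D.ket a k)).comp (D.mulLin (D.ket b l))) (D.hom_ext fun c m => ?_)
    rw [LinearMap.comp_apply]
    simp only [← mul_def, ket_mul_ket]
    by_cases hb : b = a.act k
    · subst hb
      by_cases hc : c = (a.act k).act l
      · subst hc
        have h := congrArg (fun t : Circle => (t : ℂ)) (D.theta_cocycle a k l m)
        simp only [Circle.coe_mul] at h
        simp [mul_def, ← Obj.act_mul]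
        simp [← mul_def, ket_mul_ket, smul_smul, h, mul_assoc]
      · simp [mul_def, hc]
        simp [← mul_def, ket_mul_ket, Obj.act_mul, hc]
    · by_cases hc : c = b.act l
      · simp [mul_def, hb, hc]
        simp [← mul_def, ket_mul_ket, hb]
      · simp [mul_def, hb, hc]
  have h2 : ∀ (a : D.Obj) (k : D.K) (y z : D.Alg),
      D.mulLin (D.mulLin (D.ket a k) y) z = D.mulLin (D.ket a k) (D.mulLin y z) := by
    intro a k y z
    exact LinearMap.congr_fun (f := (D.mulLin.flip z).comp (D.mulLin (D.ket a k)))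
      (g := (D.mulLin (D.ket a k)).comp (D.mulLin.flip z)) (D.hom_ext fun b l => h1 a b k l z) y
  exact LinearMap.congr_fun (f := (D.mulLin.flip z).comp (D.mulLin.flip y))
      (g := D.mulLin.flip (D.mulLin y z)) (D.hom_ext fun a k => h2 a k y z) x

variable [Finite G]

instance : Finite D.Obj :=
  Finite.of_injective (fun x : D.Obj => (x.g, x.a, x.b)) fun x y h => by
    simp only [Prod.mk.injEq] at h
    exact Obj.ext h.1 h.2.1 h.2.2

instance : Fintype D.Obj := Fintype.ofFinite _

instance : Fintype D.K := Fintype.ofFinite _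

instance : One D.Alg := ⟨∑ x : D.Obj, D.ket x 1⟩

theorem one_def : (1 : D.Alg) = ∑ x : D.Obj, D.ket x 1 := rfl

open Classical in
theorem alg_one_mul (x : D.Alg) : 1 * x = x := by
  have h : D.mulLin 1 = LinearMap.id := by
    apply D.hom_ext
    intro y k
    simp only [one_def, map_sum, LinearMap.sum_apply, ← mul_def, ket_mul_ket, Obj.act_one,
      theta_one_left]
    simp
  exact LinearMap.congr_fun h x

open Classical in
theorem alg_mul_one (x : D.Alg) : x * 1 = x := by
  have h : D.mulLin.flip 1 = LinearMap.id := by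
    apply D.hom_ext
    intro y k
    simp only [one_def, map_sum, LinearMap.flip_apply, LinearMap.sum_apply, ← mul_def,
      ket_mul_ket, theta_one_right]
    simp
  exact LinearMap.congr_fun h x

instance : Ring D.Alg where
  __ := (inferInstance : AddCommGroup D.Alg)
  mul := (· * ·)
  one := 1
  mul_assoc := D.alg_mul_assoc
  one_mul := D.alg_one_mul
  mul_one := D.alg_mul_one
  zero_mul := fun x => by rw [mul_def, map_zero, LinearMap.zero_apply]
  mul_zero := fun x => by rw [mul_def, map_zero]
  left_distrib := fun x y z => by simp only [mul_def, map_add]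
  right_distrib := fun x y z => by simp only [mul_def, map_add, LinearMap.add_apply]

instance : Algebra ℂ D.Alg :=
  Algebra.ofModule (fun c x y => by simp only [mul_def, map_smul, LinearMap.smul_apply])
    (fun c x y => by simp only [mul_def, map_smul])

/-- The star operation: the conjugate-linear extension of
`|x, k⟩ ↦ ϑ_x(k, k⁻¹)⁻¹ |x.act k, k⁻¹⟩`. -/
instance : Star D.Alg :=
  ⟨fun f => Finsupp.sum f fun u c =>
    (conj c * ((D.theta u.1 u.2 u.2⁻¹)⁻¹ : Circle)) • D.ket (u.1.act u.2) u.2⁻¹⟩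

namespace Frame

variable {D} {F : D.Frame}

instance (ρ : F.Label) : Fintype ρ.Idx :=
  haveI : Finite ρ.Idx := inferInstanceAs (Finite ({x : D.Obj // x.orbit = ρ.1} × Fin ρ.rep.dim))
  Fintype.ofFinite _

open Classical in
instance (ρ : F.Label) : DecidableEq ρ.Idx := inferInstance

end Frame

end BoundaryData

end RelGpd

end

/-! The theorem is Fourier theory on a finite groupoid. A morphism from `x` to `y` in one orbit has
the form `p z q⁻¹` with `z` in the stabiliser of the representative and `p`, `q` the chosen
connecting morphisms. Up to the unimodular factor `phase`, a matrix entry of a label on it is an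
entry of a projective representation of the stabiliser at `z`. The cocycle identity for `theta`
makes these factors multiply correctly (`phase_mul`), which gives algebra homomorphisms compatible
with the star.

Sums over morphisms collapse to sums over the stabiliser (`Label.sum_mul_mat`), so two facts about
projective representations of a finite group suffice. Schur's lemma gives orthogonality of matrix
entries (`sum_conj_mul`, `sum_conj_mul_of_not_equiv`). The regular representation, cut into minimal
invariant subspaces by orthogonal complements, shows that the simple unitary representations
separate functions (`eq_zero_of_forall_sum_smul_mat`).

By orthogonality the rescaled conjugate matrix entries are the coefficients of elements mapping to
matrix units, and separation makes the representations jointly faithful (`matrixUnits`). The algebra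
is therefore a finite product of full matrix algebras. Semisimplicity and the classification of
simple modules follow formally. Completeness is the expansion of a basis element in matrix units,
and the star laws hold because they hold for conjugate transposes in every representation. -/

noncomputable section

namespace RelGpd

/-! ### Schur's lemma and orthogonality for projective representations -/

namespace SimpleProjRep

variable {Z : Type*} [Group Z] {c : Z → Z → Circle}

theorem conjTranspose_mul_self (R : SimpleProjRep Z c) (z : Z) : (R.mat z)ᴴ * R.mat z = 1 :=
  Matrix.mem_unitaryGroup_iff'.mp (R.unitary z)

/-- Schur's lemma: an intertwiner of simple projective representations is zero or bijective. -/
theorem eq_zero_or_bijective (R S : SimpleProjRep Z c) (X : Matrix (Fin S.dim) (Fin R.dim) ℂ)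
    (hX : ∀ z, S.mat z * X = X * R.mat z) : X = 0 ∨ Function.Bijective X.mulVecLin := by
  have hzero : X.mulVecLin = 0 → X = 0 := fun h => by
    apply Matrix.toLin'.injective
    rw [map_zero, ← h]
    rfl
  have hker := R.simple (LinearMap.ker X.mulVecLin) (fun z w hw => by
    simp only [LinearMap.mem_ker, Matrix.mulVecLin_apply] at hw ⊢
    rw [Matrix.mulVec_mulVec, ← hX, ← Matrix.mulVec_mulVec, hw, Matrix.mulVec_zero])
  have hran := S.simple (LinearMap.range X.mulVecLin) (fun z w hw => by
    obtain ⟨v, rfl⟩ := hw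
    refine ⟨R.mat z *ᵥ v, ?_⟩
    simp only [Matrix.mulVecLin_apply, Matrix.mulVec_mulVec, hX])
  rcases hker with hker | hker
  · rcases hran with hran | hran
    · exact Or.inl (hzero (LinearMap.range_eq_bot.mp hran))
    · exact Or.inr ⟨LinearMap.ker_eq_bot.mp hker, LinearMap.range_eq_top.mp hran⟩
  · exact Or.inl (hzero (LinearMap.ker_eq_top.mp hker))

theorem eq_zero_of_not_equiv (R S : SimpleProjRep Z c)
    (h : ¬ (SimpleProjRep.equivalence c).r R S) (X : Matrix (Fin S.dim) (Fin R.dim) ℂ)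
    (hX : ∀ z, S.mat z * X = X * R.mat z) : X = 0 := by
  refine (eq_zero_or_bijective R S X hX).resolve_right fun hb => h ?_
  refine ⟨LinearEquiv.ofBijective X.mulVecLin hb, fun z v => ?_⟩
  simp only [LinearEquiv.ofBijective_apply, Matrix.mulVecLin_apply, Matrix.mulVec_mulVec, hX]

/-- Over `ℂ` the intertwiner has an eigenvalue `a`. Then `X - a` is an intertwiner with nonzero
kernel, hence not bijective, hence zero. -/
theorem exists_eq_smul_one (R : SimpleProjRep Z c) (X : Matrix (Fin R.dim) (Fin R.dim) ℂ)
    (hX : ∀ z, R.mat z * X = X * R.mat z) : ∃ a : ℂ, X = a • 1 := by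
  have : Nonempty (Fin R.dim) := ⟨⟨0, R.dim_pos⟩⟩
  obtain ⟨a, ha⟩ := Module.End.exists_eigenvalue X.mulVecLin
  obtain ⟨v, hv⟩ := ha.exists_hasEigenvector
  refine ⟨a, sub_eq_zero.mp ((eq_zero_or_bijective R R (X - a • 1) fun z => ?_).resolve_right
    fun hb => hv.2 (hb.1 ?_))⟩
  · simp [mul_sub, sub_mul, hX]
  · have := hv.apply_eq_smul
    simp only [Matrix.mulVecLin_apply] at this
    simp [this]

section Orthogonality

variable [Fintype Z]

/-- The average of a matrix over two projective representations. -/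
def average (R S : SimpleProjRep Z c) (E : Matrix (Fin S.dim) (Fin R.dim) ℂ) :
    Matrix (Fin S.dim) (Fin R.dim) ℂ :=
  ∑ z, S.mat z * E * (R.mat z)ᴴ

/-- Conjugation by `w` permutes the summands by left translation. Both representations have the same
cocycle, so the two scalars it produces are conjugate phases and cancel. -/
theorem mul_average (R S : SimpleProjRep Z c) (E : Matrix (Fin S.dim) (Fin R.dim) ℂ) (w : Z) :
    S.mat w * average R S E = average R S E * R.mat w := by
  have h : S.mat w * average R S E * (R.mat w)ᴴ = average R S E := by
    rw [average, Matrix.mul_sum, Matrix.sum_mul]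
    refine Fintype.sum_equiv (Equiv.mulLeft w) _ _ fun z => ?_
    have e : S.mat w * (S.mat z * E * (R.mat z)ᴴ) * (R.mat w)ᴴ =
        (S.mat w * S.mat z) * E * (R.mat w * R.mat z)ᴴ := by
      simp only [Matrix.conjTranspose_mul, Matrix.mul_assoc]
    rw [e, S.mat_mul, R.mat_mul, Matrix.conjTranspose_smul]
    simp only [Matrix.smul_mul, Matrix.mul_smul, smul_smul, Equiv.coe_mulLeft]
    rw [Complex.star_def, ← Complex.normSq_eq_conj_mul_self, Circle.normSq_coe]
    simp
  conv_rhs => rw [← h]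
  rw [Matrix.mul_assoc, conjTranspose_mul_self, Matrix.mul_one]

/-- Averaging a matrix unit turns a statement about intertwiners into one about sums of products of
matrix entries. -/
theorem average_single_apply (R S : SimpleProjRep Z c) (i j : Fin R.dim) (k l : Fin S.dim) :
    average R S (Matrix.single l j 1) k i = ∑ z, conj (R.mat z i j) * S.mat z k l := by
  rw [average, Matrix.sum_apply]
  refine Finset.sum_congr rfl fun z _ => ?_
  rw [Matrix.mul_assoc, Matrix.mul_apply, Finset.sum_eq_single l]
  · simp [mul_comm]
  · intro b _ hb
    rw [Matrix.single_mul_apply_of_ne _ _ _ _ _ hb, mul_zero]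
  · simp

theorem sum_conj_mul_of_not_equiv (R S : SimpleProjRep Z c)
    (h : ¬ (SimpleProjRep.equivalence c).r R S) (i j : Fin R.dim) (k l : Fin S.dim) :
    ∑ z, conj (R.mat z i j) * S.mat z k l = 0 := by
  rw [← average_single_apply, eq_zero_of_not_equiv R S h _ (mul_average R S _), Matrix.zero_apply]

theorem sum_conj_mul (R : SimpleProjRep Z c) (i j k l : Fin R.dim) :
    ∑ z, conj (R.mat z i j) * R.mat z k l =
      if i = k ∧ j = l then (Fintype.card Z : ℂ) / R.dim else 0 := by
  obtain ⟨a, ha⟩ := exists_eq_smul_one R _ (mul_average R R (Matrix.single l j 1))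
  -- Unitary conjugation preserves the trace, so each summand has trace `δ_{jl}`; comparison with
  -- the trace of `a • 1` determines `a`.
  have htr : a * R.dim = if j = l then (Fintype.card Z : ℂ) else 0 := by
    have h := congrArg Matrix.trace ha
    rw [average, Matrix.trace_sum, Matrix.trace_smul, Matrix.trace_one, Fintype.card_fin] at h
    rw [← smul_eq_mul, ← h]
    have : ∀ z, (R.mat z * Matrix.single l j 1 * (R.mat z)ᴴ).trace =
        if j = l then (1 : ℂ) else 0 := by
      intro z
      rw [Matrix.mul_assoc, Matrix.trace_mul_comm, Matrix.mul_assoc, conjTranspose_mul_self,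
        Matrix.mul_one]
      by_cases hjl : j = l
      · subst hjl; simp
      · rw [if_neg hjl, Matrix.trace_single_eq_of_ne _ _ _ (Ne.symm hjl)]
    simp only [this]
    split_ifs <;> simp
  have hd : (R.dim : ℂ) ≠ 0 := Nat.cast_ne_zero.mpr R.dim_pos.ne'
  rw [← average_single_apply, ha, Matrix.smul_apply, Matrix.one_apply, smul_eq_mul]
  by_cases hik : i = k <;> by_cases hjl : j = l
  · subst hik hjl
    simp only [if_true, mul_one, and_self] at htr ⊢
    rw [eq_div_iff hd, htr]
  · have : a = 0 := by simpa [hjl, hd] using htr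
    simp [hjl, this]
  · simp [hik, Ne.symm hik]
  · simp [hik, Ne.symm hik]

end Orthogonality

end SimpleProjRep

/-! ### Complete reducibility and the regular projective representation -/

section Regular

variable {Z : Type*} [Group Z] {c : Z → Z → Circle}

section Unitary

variable {V : Type*} [NormedAddCommGroup V] [InnerProductSpace ℂ V]
  (U : Z → V →ₗ[ℂ] V)

/-- Up to a phase, `w ∈ W` is `U z` applied to the vector `U z⁻¹ w` of `W`, so the unitary `U z` can
be removed from both sides of the inner product. -/
theorem orthogonal_invariant
    (hmul : ∀ z w v, U z (U w v) = (c z w : ℂ) • U (z * w) v)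
    (hone : ∀ v, U 1 v = v) (hinner : ∀ z v w, inner ℂ (U z v) (U z w) = inner ℂ v w)
    {W : Submodule ℂ V} (hW : ∀ z, ∀ w ∈ W, U z w ∈ W) (z : Z) :
    ∀ w ∈ Wᗮ, U z w ∈ Wᗮ := by
  intro v hv
  rw [Submodule.mem_orthogonal] at hv ⊢
  intro w hw
  have h : w = (c z z⁻¹ : ℂ)⁻¹ • U z (U z⁻¹ w) := by
    rw [hmul, mul_inv_cancel, hone, inv_smul_smul₀ (Circle.coe_ne_zero _)]
  rw [h, inner_smul_left, hinner, hv _ (hW _ _ hw), mul_zero]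

variable [FiniteDimensional ℂ V]

/-- A minimal invariant subspace of a unitary projective representation, in matrix form. -/
def SimpleProjRep.ofMinimal
    (hmul : ∀ z w v, U z (U w v) = (c z w : ℂ) • U (z * w) v)
    (hinner : ∀ z v w, inner ℂ (U z v) (U z w) = inner ℂ v w)
    (W : Submodule ℂ V) (hW : ∀ z, ∀ w ∈ W, U z w ∈ W) (h0 : W ≠ ⊥)
    (hmin : ∀ W' ≤ W, (∀ z, ∀ w ∈ W', U z w ∈ W') → W' = ⊥ ∨ W' = W) : SimpleProjRep Z c where
  dim := Module.finrank ℂ W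
  dim_pos := by
    have := Submodule.nontrivial_iff_ne_bot.mpr h0
    exact Module.finrank_pos
  mat z := LinearMap.toMatrix (stdOrthonormalBasis ℂ W).toBasis (stdOrthonormalBasis ℂ W).toBasis
    ((U z).restrict (hW z))
  unitary z := by
    rw [Matrix.mem_unitaryGroup_iff']
    ext i k
    rw [Matrix.mul_apply]
    -- In an orthonormal basis the entries are inner products `⟨b j, U b k⟩`, and Parseval's
    -- identity reduces unitarity of the matrix to that of `U z`.
    have : ∀ j k, (LinearMap.toMatrix (stdOrthonormalBasis ℂ W).toBasis
        (stdOrthonormalBasis ℂ W).toBasis ((U z).restrict (hW z))) j k =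
        inner ℂ (stdOrthonormalBasis ℂ W j)
          ((U z).restrict (hW z) (stdOrthonormalBasis ℂ W k)) := by
      intro j k
      simp [LinearMap.toMatrix_apply, OrthonormalBasis.repr_apply_apply]
    simp only [Matrix.star_apply, this, Complex.star_def, inner_conj_symm,
      OrthonormalBasis.sum_inner_mul_inner]
    rw [Submodule.coe_inner, LinearMap.coe_restrict_apply, LinearMap.coe_restrict_apply, hinner,
      ← Submodule.coe_inner, orthonormal_iff_ite.mp (stdOrthonormalBasis ℂ W).orthonormal,
      Matrix.one_apply]
  mat_mul z w := by
    rw [← LinearMap.toMatrix_mul, ← map_smul]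
    congr 1
    ext v
    simp [hmul]
  simple W' hW' := by
    -- An invariant subspace of the coordinate space is carried back to a subspace of `W`, where
    -- minimality applies.
    set b := (stdOrthonormalBasis ℂ W).toBasis with hb
    have hinv : ∀ z, ∀ w ∈ (W'.comap b.equivFun.toLinearMap).map W.subtype,
        U z w ∈ (W'.comap b.equivFun.toLinearMap).map W.subtype := by
      rintro z _ ⟨w, hw, rfl⟩
      refine ⟨(U z).restrict (hW z) w, ?_, rfl⟩
      have := hW' z _ hw
      rw [SetLike.mem_coe, Submodule.mem_comap]
      convert this using 1
      exact (LinearMap.toMatrix_mulVec_repr b b _ w).symm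
    rcases hmin _ (Submodule.map_subtype_le W _) hinv with h | h
    · left
      replace h := Submodule.map_injective_of_injective W.injective_subtype
        (h.trans (Submodule.map_bot _).symm)
      rw [eq_bot_iff]
      intro v hv
      have hv' : b.equivFun.symm v ∈ W'.comap b.equivFun.toLinearMap := by
        rwa [Submodule.mem_comap, LinearEquiv.coe_coe, LinearEquiv.apply_symm_apply]
      rw [h, Submodule.mem_bot] at hv'
      exact (LinearEquiv.map_eq_zero_iff _).mp hv'
    · right
      rw [eq_top_iff]
      intro v _
      have hv : (b.equivFun.symm v : V) ∈ (W'.comap b.equivFun.toLinearMap).map W.subtype := by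
        rw [h]
        exact (b.equivFun.symm v).2
      obtain ⟨w, hw, hwv⟩ := hv
      have := W.injective_subtype hwv
      subst this
      rwa [SetLike.mem_coe, Submodule.mem_comap, LinearEquiv.coe_coe,
        LinearEquiv.apply_symm_apply] at hw

/-- Complete reducibility as an induction on a dimension bound `n`. A minimal `W` is a simple
representation, to which `hf` applies; otherwise `W` is the sum of a proper invariant subspace and
its orthogonal complement in `W`, both of smaller dimension. -/
theorem sum_smul_apply_eq_zero [Fintype Z]
    (hmul : ∀ z w v, U z (U w v) = (c z w : ℂ) • U (z * w) v)
    (hone : ∀ v, U 1 v = v) (hinner : ∀ z v w, inner ℂ (U z v) (U z w) = inner ℂ v w)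
    (f : Z → ℂ)
    (hf : ∀ R : SimpleProjRep Z c, ∑ z, f z • R.mat z = 0) (n : ℕ) :
    ∀ W : Submodule ℂ V, Module.finrank ℂ W ≤ n → (∀ z, ∀ w ∈ W, U z w ∈ W) →
      ∀ w ∈ W, ∑ z, f z • U z w = 0 := by
  induction n with
  | zero =>
    intro W hn _ w hw
    rw [Nat.le_zero, Submodule.finrank_eq_zero] at hn
    rw [hn, Submodule.mem_bot] at hw
    simp [hw]
  | succ n ih =>
    intro W hn hW w hw
    by_cases h0 : W = ⊥
    · rw [h0, Submodule.mem_bot] at hw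
      simp [hw]
    by_cases hmin : ∀ W' ≤ W, (∀ z, ∀ w ∈ W', U z w ∈ W') → W' = ⊥ ∨ W' = W
    · have h := hf (SimpleProjRep.ofMinimal U hmul hinner W hW h0 hmin)
      have h2 : ∑ z, f z • (U z).restrict (hW z) = 0 := by
        apply (LinearMap.toMatrix (stdOrthonormalBasis ℂ W).toBasis
          (stdOrthonormalBasis ℂ W).toBasis).injective
        rw [map_sum, map_zero]
        simp only [map_smul]
        exact h
      have h3 := congrArg W.subtype (LinearMap.congr_fun h2 ⟨w, hw⟩)
      simpa using h3
    · push Not at hmin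
      obtain ⟨W', hle, hinv, hb, hne⟩ := hmin
      have hlt := Submodule.finrank_lt_finrank_of_lt (lt_of_le_of_ne hle hne)
      have hinv2 : ∀ z, ∀ w ∈ W'ᗮ ⊓ W, U z w ∈ W'ᗮ ⊓ W := fun z w hw =>
        ⟨orthogonal_invariant U hmul hone hinner hinv z w hw.1, hW z w hw.2⟩
      have hlt2 : Module.finrank ℂ (W'ᗮ ⊓ W : Submodule ℂ V) < Module.finrank ℂ W := by
        apply Submodule.finrank_lt_finrank_of_lt
        refine lt_of_le_of_ne inf_le_right fun h => hb ?_
        rw [eq_bot_iff, ← Submodule.inf_orthogonal_eq_bot W']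
        exact le_inf le_rfl (hle.trans (inf_eq_right.mp h))
      have hsup := Submodule.sup_orthogonal_inf_of_hasOrthogonalProjection hle
      rw [← hsup] at hw
      obtain ⟨u, hu, v, hv, rfl⟩ := Submodule.mem_sup.mp hw
      simp only [map_add, smul_add, Finset.sum_add_distrib]
      rw [ih W' (by omega) hinv u hu, ih _ (by omega) hinv2 v hv, add_zero]

end Unitary

/-- The regular `c`-projective representation. -/
def regularRep [Fintype Z] (c : Z → Z → Circle) (z : Z) :
    EuclideanSpace ℂ Z →ₗ[ℂ] EuclideanSpace ℂ Z where
  toFun v := WithLp.toLp 2 fun w => (c z (z⁻¹ * w) : ℂ) * v (z⁻¹ * w)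
  map_add' u v := by ext w; simp [mul_add]
  map_smul' a v := by ext w; simp [mul_left_comm]

theorem regularRep_apply [Fintype Z] (z : Z) (v : EuclideanSpace ℂ Z) (w : Z) :
    regularRep c z v w = (c z (z⁻¹ * w) : ℂ) * v (z⁻¹ * w) := rfl

/-- Simple unitary projective representations separate the twisted group algebra. -/
theorem eq_zero_of_forall_sum_smul_mat [Fintype Z]
    (hc : ∀ k l m, c k l * c (k * l) m = c l m * c k (l * m)) (h1 : ∀ k, c 1 k = 1) (f : Z → ℂ)
    (hf : ∀ R : SimpleProjRep Z c, ∑ z, f z • R.mat z = 0) : f = 0 := by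
  classical
  have hmul : ∀ z w v, regularRep c z (regularRep c w v) =
      (c z w : ℂ) • regularRep c (z * w) v := by
    intro z w v
    ext x
    have h := congrArg (fun t : Circle => (t : ℂ)) (hc z w (w⁻¹ * (z⁻¹ * x)))
    simp only [Circle.coe_mul, mul_inv_cancel_left] at h
    simp only [regularRep_apply, PiLp.smul_apply, smul_eq_mul, mul_inv_rev, mul_assoc] at h ⊢
    rw [← mul_assoc, ← mul_assoc (c z w : ℂ), h]
    ring
  have hone : ∀ v, regularRep c 1 v = v := by
    intro v
    ext x
    simp [regularRep_apply, h1]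
  have hinner : ∀ z v w, inner ℂ (regularRep c z v) (regularRep c z w) = inner ℂ v w := by
    intro z v w
    rw [PiLp.inner_apply, PiLp.inner_apply]
    refine Fintype.sum_equiv (Equiv.mulLeft z⁻¹) _ _ fun x => ?_
    have hu : conj (c z (z⁻¹ * x) : ℂ) * c z (z⁻¹ * x) = 1 := by
      rw [← Complex.normSq_eq_conj_mul_self, Circle.normSq_coe, Complex.ofReal_one]
    simp only [regularRep_apply, RCLike.inner_apply, map_mul, Equiv.coe_mulLeft]
    linear_combination (w (z⁻¹ * x) * conj (v (z⁻¹ * x))) * hu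
  -- The delta function at `1` is a separating vector: the value at `x` of the resulting sum is `f
  -- x` times the phase `c x 1`.
  have h := sum_smul_apply_eq_zero (regularRep c) hmul hone hinner f hf _ ⊤ le_rfl
    (fun _ _ _ => trivial) (EuclideanSpace.single 1 1) trivial
  funext x
  have hx := congrArg (fun v : EuclideanSpace ℂ Z => v x) h
  simp only [WithLp.ofLp_sum, Finset.sum_apply, PiLp.smul_apply, regularRep_apply,
    PiLp.zero_apply] at hx
  rw [Finset.sum_eq_single x] at hx
  · simpa using hx
  · intro z _ hz
    have : z⁻¹ * x ≠ 1 := fun h => hz (inv_mul_eq_one.mp h)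
    simp [this]
  · simp

end Regular

theorem Circle.conj_mul_self (t : Circle) : conj (t : ℂ) * t = 1 := by
  rw [← Complex.normSq_eq_conj_mul_self, Circle.normSq_coe, Complex.ofReal_one]

/-! ### Identity, adjoints and change of representative -/

namespace SimpleProjRep

variable {Z : Type*} [Group Z] {c : Z → Z → Circle}

/-- This transfers vanishing between representatives of a class, so that only the chosen ones have
to be tested. -/
theorem sum_smul_mat_eq_zero_of_equiv [Fintype Z] {R S : SimpleProjRep Z c}
    (h : (SimpleProjRep.equivalence c).r R S) (f : Z → ℂ) (hf : ∑ z, f z • R.mat z = 0) :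
    ∑ z, f z • S.mat z = 0 := by
  obtain ⟨e, he⟩ := h
  apply Matrix.toLin'.injective
  refine LinearMap.ext fun v => ?_
  obtain ⟨v, rfl⟩ := e.surjective v
  have h2 := congrArg e (congrArg (fun M => M *ᵥ v) hf)
  simpa [Matrix.sum_mulVec, Matrix.smul_mulVec, he] using h2

/-- The matrix of `1` is idempotent and invertible. -/
theorem mat_one (R : SimpleProjRep Z c) (hc : c 1 1 = 1) : R.mat 1 = 1 := by
  have h := R.mat_mul 1 1
  rw [hc, Circle.coe_one, one_smul, mul_one] at h
  have h2 := congrArg (fun M => (R.mat 1)ᴴ * M) h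
  simpa only [← Matrix.mul_assoc, conjTranspose_mul_self, Matrix.one_mul] using h2

theorem conjTranspose_mat (R : SimpleProjRep Z c) (hc : c 1 1 = 1) (z : Z) :
    (R.mat z)ᴴ = (c z z⁻¹ : ℂ)⁻¹ • R.mat z⁻¹ := by
  have h := R.mat_mul z z⁻¹
  rw [mul_inv_cancel, R.mat_one hc] at h
  have h2 := congrArg (fun M => (R.mat z)ᴴ * M) h
  simp only [← Matrix.mul_assoc, conjTranspose_mul_self, Matrix.one_mul, Matrix.mul_smul,
    Matrix.mul_one] at h2
  rw [h2, inv_smul_smul₀ (Circle.coe_ne_zero _)]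

end SimpleProjRep

/-! ### Phases and matrix entries along morphisms -/

namespace BoundaryData

variable {G : Type*} [Group G] (D : BoundaryData G)

theorem stabCocycle_cocycle (x : D.Obj) (k l m : D.stab x) :
    D.stabCocycle x k l * D.stabCocycle x (k * l) m =
      D.stabCocycle x l m * D.stabCocycle x k (l * m) := by
  have h := D.theta_cocycle x k l m
  rw [show x.act k = x from k.2] at h
  exact h

theorem stabCocycle_one_left (x : D.Obj) (k : D.stab x) : D.stabCocycle x 1 k = 1 :=
  D.theta_one_left x k

/-- The phase of the matrix of a morphism `k`, seen from the object `o` along morphisms `p`, `q`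
from its source and its target to `o`. -/
def phase (o : D.Obj) (p q k : D.K) : Circle :=
  D.theta o p⁻¹ k / D.theta o (p⁻¹ * k * q) q⁻¹

/-- With `z = p⁻¹kq` and `w = q⁻¹lr`, this combines the cocycle identities at `o` for the triples
`(p⁻¹, k, l)`, `(z, q⁻¹, l)` and `(z, w, r⁻¹)`. Since `z` fixes `o`, the last two have all their
shifted terms based at `o` again. -/
theorem phase_mul {o x : D.Obj} {p q r k l : D.K} (hp : x.act p = o)
    (hz : o.act (p⁻¹ * k * q) = o) :
    D.phase o p q k * D.phase o q r l * D.theta o (p⁻¹ * k * q) (q⁻¹ * l * r) =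
      D.theta x k l * D.phase o p r (k * l) := by
  have hx : o.act p⁻¹ = x := by rw [← hp, ← Obj.act_mul, mul_inv_cancel, Obj.act_one]
  have h1 := D.theta_cocycle o p⁻¹ k l
  have h2 := D.theta_cocycle o (p⁻¹ * k * q) q⁻¹ l
  have h3 := D.theta_cocycle o (p⁻¹ * k * q) (q⁻¹ * l * r) r⁻¹
  rw [hx] at h1
  rw [hz] at h2 h3
  have e1 : p⁻¹ * k * q * q⁻¹ = p⁻¹ * k := by group
  have e2 : q⁻¹ * l * r * r⁻¹ = q⁻¹ * l := by group
  have e3 : p⁻¹ * k * q * (q⁻¹ * l * r) = p⁻¹ * (k * l) * r := by group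
  rw [e1] at h2
  rw [e2, e3] at h3
  unfold phase
  -- With the ten values of `theta` opaque, the claim is linear in an abelian group: the first
  -- identity minus the second plus the third.
  generalize D.theta o p⁻¹ k = t1 at *
  generalize D.theta o (p⁻¹ * k) l = t2 at *
  generalize D.theta x k l = t3 at *
  generalize D.theta o p⁻¹ (k * l) = t4 at *
  generalize D.theta o (p⁻¹ * k * q) q⁻¹ = t5 at *
  generalize D.theta o q⁻¹ l = t6 at *
  generalize D.theta o (p⁻¹ * k * q) (q⁻¹ * l) = t7 at *
  generalize D.theta o (p⁻¹ * k * q) (q⁻¹ * l * r) = t8 at *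
  generalize D.theta o (p⁻¹ * (k * l) * r) r⁻¹ = t9 at *
  generalize D.theta o (q⁻¹ * l * r) r⁻¹ = t10 at *
  apply Additive.ofMul.injective
  replace h1 := congrArg Additive.ofMul h1
  replace h2 := congrArg Additive.ofMul h2
  replace h3 := congrArg Additive.ofMul h3
  simp only [ofMul_mul, ofMul_div] at h1 h2 h3 ⊢
  rw [← sub_eq_zero] at h1 h2 h3 ⊢
  have key := congrArg₂ (· + ·) (congrArg₂ (· - ·) h1 h2) h3
  simp only [sub_zero, add_zero] at key
  exact Eq.trans (by abel) key

theorem phase_one (o : D.Obj) (p : D.K) : D.phase o p p 1 = 1 := by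
  simp [phase, theta_one_left, theta_one_right]

theorem orbit_act (x : D.Obj) (k : D.K) : (x.act k).orbit = x.orbit :=
  (Quotient.sound (s := D.orbitRel) ⟨k, rfl⟩).symm

namespace Frame

variable {D} {F : D.Frame}

theorem act_conn_inv {O : D.Orbit} {x : D.Obj} (hx : x.orbit = O) :
    (F.base O).act (F.conn x)⁻¹ = x := by
  subst hx
  rw [← F.act_conn, ← Obj.act_mul, mul_inv_cancel, Obj.act_one]

theorem act_conn' {O : D.Orbit} {x : D.Obj} (hx : x.orbit = O) :
    x.act (F.conn x) = F.base O := by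
  rw [F.act_conn, hx]

theorem act_conn_mul_mul {O : D.Orbit} {x y : D.Obj} (hx : x.orbit = O) (hy : y.orbit = O)
    (z : D.stab (F.base O)) : x.act (F.conn x * z * (F.conn y)⁻¹) = y := by
  rw [Obj.act_mul, Obj.act_mul, act_conn' hx, show (F.base O).act z = F.base O from z.2,
    act_conn_inv hy]

/-- Orbits are the cosets of the stabilisers. -/
def orbitEquiv (F : D.Frame) (O : D.Orbit) :
    D.K ≃ {x : D.Obj // x.orbit = O} × D.stab (F.base O) where
  toFun k := ⟨⟨(F.base O).act k, (D.orbit_act _ _).trans (F.orbit_base O)⟩,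
    ⟨k * F.conn ((F.base O).act k), by
      change (F.base O).act _ = F.base O
      rw [Obj.act_mul, act_conn' ((D.orbit_act _ _).trans (F.orbit_base O))]⟩⟩
  invFun u := u.2 * (F.conn u.1.1)⁻¹
  left_inv k := by simp
  right_inv u := by
    obtain ⟨⟨x, hx⟩, z, hz⟩ := u
    have h : (F.base O).act (z * (F.conn x)⁻¹) = x := by
      rw [Obj.act_mul, show (F.base O).act z = F.base O from hz, act_conn_inv hx]
    ext1
    · exact Subtype.ext h
    · apply Subtype.ext
      simp [h]

/-- The index `[i m]` with `x = 𝔬ᵢ`. -/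
def Label.idx (ρ : F.Label) (x : D.Obj) (hx : x.orbit = ρ.1) (m : Fin ρ.rep.dim) : ρ.Idx :=
  (⟨x, hx⟩, m)

theorem Label.exists_idx (ρ : F.Label) (I : ρ.Idx) : ∃ x hx m, I = ρ.idx x hx m :=
  ⟨I.1.1, I.1.2, I.2, rfl⟩

theorem Label.idx_inj (ρ : F.Label) {x y : D.Obj} {hx : x.orbit = ρ.1} {hy : y.orbit = ρ.1}
    {m n : Fin ρ.rep.dim} : ρ.idx x hx m = ρ.idx y hy n ↔ x = y ∧ m = n := by
  constructor
  · intro h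
    exact ⟨congrArg (fun I : ρ.Idx => I.1.1) h, congrArg (fun I : ρ.Idx => I.2) h⟩
  · rintro ⟨rfl, rfl⟩
    rfl

theorem Label.mat_idx (ρ : F.Label) {x y : D.Obj} {k : D.K} (hx : x.orbit = ρ.1)
    (hy : y.orbit = ρ.1) (m n : Fin ρ.rep.dim) (h : x.act k = y) :
    ρ.mat x k (ρ.idx x hx m) (ρ.idx y hy n) = (D.phase ρ.base (F.conn x) (F.conn y) k : ℂ) *
      ρ.rep.mat ⟨(F.conn x)⁻¹ * k * F.conn y, mem_stab hx hy h⟩ m n := by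
  refine (dif_pos ⟨rfl, h⟩).trans ?_
  rw [phase, Circle.coe_div]
  rfl

theorem Label.mat_idx_of_not (ρ : F.Label) {u x y : D.Obj} {k : D.K} {hx : x.orbit = ρ.1}
    {hy : y.orbit = ρ.1} {m n : Fin ρ.rep.dim} (h : ¬ (u = x ∧ u.act k = y)) :
    ρ.mat u k (ρ.idx x hx m) (ρ.idx y hy n) = 0 :=
  dif_neg h

/-- Here `z ↦ p z q⁻¹` parametrises the morphisms from `x` to `y` by the stabiliser, which is the
form needed for summation. -/
theorem Label.mat_idx_conn (ρ : F.Label) {x y : D.Obj} (hx : x.orbit = ρ.1)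
    (hy : y.orbit = ρ.1) (m n : Fin ρ.rep.dim) (z : D.stab ρ.base) :
    ρ.mat x (F.conn x * z * (F.conn y)⁻¹) (ρ.idx x hx m) (ρ.idx y hy n) =
      (D.phase ρ.base (F.conn x) (F.conn y) (F.conn x * z * (F.conn y)⁻¹) : ℂ) *
        ρ.rep.mat z m n := by
  rw [ρ.mat_idx hx hy m n (act_conn_mul_mul hx hy z)]
  congr 3
  group

theorem rep_eq_of_equiv {O : D.Orbit}
    {R R' : IrrClass (D.stab (F.base O)) (D.stabCocycle (F.base O))}
    (h : (SimpleProjRep.equivalence (D.stabCocycle (F.base O))).r (F.rep O R) (F.rep O R')) :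
    R = R' := by
  rw [← F.rep_mem O R, ← F.rep_mem O R']
  exact Quotient.sound h

theorem Label.stabCocycle_one_one (ρ : F.Label) : D.stabCocycle ρ.base 1 1 = 1 :=
  D.stabCocycle_one_left _ _

/-- This is compatibility with the star on basis elements, entry by entry. It rests on the formula
for the adjoint of a unitary projective representation and on the phases of `k` and `k⁻¹`. -/
theorem Label.conj_mat (ρ : F.Label) (x : D.Obj) (k : D.K) (I J : ρ.Idx) :
    conj (ρ.mat x k I J) = (D.theta x k k⁻¹ : ℂ)⁻¹ * ρ.mat (x.act k) k⁻¹ J I := by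
  have hinv : (x.act k).act k⁻¹ = x := by rw [← Obj.act_mul, mul_inv_cancel, Obj.act_one]
  obtain ⟨i, hi, m, rfl⟩ := ρ.exists_idx I
  obtain ⟨j, hj, n, rfl⟩ := ρ.exists_idx J
  by_cases h : x = i ∧ x.act k = j
  · obtain ⟨rfl, rfl⟩ := h
    rw [ρ.mat_idx hi hj m n rfl, ρ.mat_idx hj hi n m hinv, map_mul]
    set z : D.stab ρ.base := ⟨(F.conn x)⁻¹ * k * F.conn (x.act k), mem_stab hi hj rfl⟩ with hz
    have hzi : (⟨(F.conn (x.act k))⁻¹ * k⁻¹ * F.conn x, mem_stab hj hi hinv⟩ : D.stab ρ.base) =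
        z⁻¹ := by
      apply Subtype.ext
      simp [hz, mul_assoc]
    have hR := congrFun (congrFun (ρ.rep.conjTranspose_mat ρ.stabCocycle_one_one z) n) m
    rw [Matrix.conjTranspose_apply, Matrix.smul_apply, smul_eq_mul, Complex.star_def] at hR
    -- The composite of `k` and `k⁻¹` has phase `1`, so `ϑ_x(k, k⁻¹)` is the product of the two
    -- phases and the stabiliser cocycle at `(z, z⁻¹)`.
    have hp := congrArg (fun t : Circle => (t : ℂ)) (D.phase_mul (o := ρ.base) (x := x)
        (p := F.conn x) (q := F.conn (x.act k)) (r := F.conn x) (k := k) (l := k⁻¹)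
        (act_conn' hi) z.2)
    have hc : D.theta ρ.base ((F.conn x)⁻¹ * k * F.conn (x.act k))
        ((F.conn (x.act k))⁻¹ * k⁻¹ * F.conn x) = D.stabCocycle ρ.base z z⁻¹ := by
      rw [← hzi]; rfl
    rw [mul_inv_cancel, D.phase_one, hc] at hp
    simp only [Circle.coe_mul, mul_one] at hp
    rw [hR, hzi, ← hp]
    have h1 := Circle.conj_mul_self (D.phase ρ.base (F.conn x) (F.conn (x.act k)) k)
    have h2 := Circle.coe_ne_zero (D.phase ρ.base (F.conn x) (F.conn (x.act k)) k)
    have h3 := Circle.coe_ne_zero (D.phase ρ.base (F.conn (x.act k)) (F.conn x) k⁻¹)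
    have h4 := Circle.coe_ne_zero (D.stabCocycle ρ.base z z⁻¹)
    field_simp
    linear_combination (ρ.rep.mat z⁻¹ n m) * h1
  · rw [ρ.mat_idx_of_not h, map_zero, ρ.mat_idx_of_not, mul_zero]
    exact fun h2 => h ⟨hinv.symm.trans h2.2, h2.1⟩

/-! ### Multiplicativity, orthogonality and separation for the label matrices -/

variable [Finite G]

instance (x : D.Obj) : Fintype (D.stab x) := Fintype.ofFinite _

theorem card_eq_mul_card_stab (F : D.Frame) (O : D.Orbit) :
    Nat.card D.A * Nat.card D.B =
      Nat.card {x : D.Obj // x.orbit = O} * Fintype.card (D.stab (F.base O)) := by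
  rw [← Nat.card_prod, Nat.card_congr (F.orbitEquiv O), Nat.card_prod, Nat.card_eq_fintype_card
    (α := D.stab (F.base O))]

theorem Label.mat_mul_mat_of_ne (ρ : F.Label) {x y : D.Obj} {k l : D.K} (h : y ≠ x.act k) :
    ρ.mat x k * ρ.mat y l = 0 := by
  ext I J
  rw [Matrix.mul_apply, Matrix.zero_apply]
  refine Finset.sum_eq_zero fun K _ => ?_
  obtain ⟨i, hi, m, rfl⟩ := ρ.exists_idx I
  obtain ⟨j, hj, n, rfl⟩ := ρ.exists_idx J
  obtain ⟨u, hu, q, rfl⟩ := ρ.exists_idx K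
  by_cases h1 : x = i ∧ x.act k = u
  · rw [ρ.mat_idx_of_not (u := y) fun h2 => h (h2.1.trans h1.2.symm), mul_zero]
  · rw [ρ.mat_idx_of_not h1, zero_mul]

theorem Label.mat_mul_mat (ρ : F.Label) (x : D.Obj) (k l : D.K) :
    ρ.mat x k * ρ.mat (x.act k) l = (D.theta x k l : ℂ) • ρ.mat x (k * l) := by
  ext I J
  rw [Matrix.mul_apply, Matrix.smul_apply, smul_eq_mul]
  obtain ⟨i, hi, m, rfl⟩ := ρ.exists_idx I
  obtain ⟨j, hj, n, rfl⟩ := ρ.exists_idx J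
  by_cases h : x = i ∧ x.act (k * l) = j
  · obtain ⟨rfl, rfl⟩ := h
    have hy : (x.act k).orbit = ρ.1 := (D.orbit_act x k).trans hi
    have hl : (x.act k).act l = x.act (k * l) := (Obj.act_mul _ _ _).symm
    rw [ρ.mat_idx hi hj m n rfl]
    -- Only intermediate indices lying over the object `x.act k` contribute.
    refine (Finset.sum_of_injOn (fun q => ρ.idx (x.act k) hy q) (s := Finset.univ)
      (f := fun q => ρ.mat x k (ρ.idx x hi m) (ρ.idx (x.act k) hy q) *
        ρ.mat (x.act k) l (ρ.idx (x.act k) hy q) (ρ.idx (x.act (k * l)) hj n))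
      ?_ (by simp) ?_ fun _ _ => rfl).symm.trans ?_
    · intro q _ q' _ hq
      exact (ρ.idx_inj.mp hq).2
    · intro K _ hK
      obtain ⟨u, hu, q, rfl⟩ := ρ.exists_idx K
      rw [ρ.mat_idx_of_not (u := x), zero_mul]
      rintro ⟨-, rfl⟩
      exact hK ⟨q, by simp, rfl⟩
    · simp only [ρ.mat_idx hi hy m _ rfl, ρ.mat_idx hy hj _ n hl]
      have hm := congrFun (congrFun (ρ.rep.mat_mul
        ⟨(F.conn x)⁻¹ * k * F.conn (x.act k), mem_stab hi hy rfl⟩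
        ⟨(F.conn (x.act k))⁻¹ * l * F.conn (x.act (k * l)), mem_stab hy hj hl⟩) m) n
      rw [Matrix.mul_apply, Matrix.smul_apply, smul_eq_mul] at hm
      have hz : (⟨(F.conn x)⁻¹ * k * F.conn (x.act k), mem_stab hi hy rfl⟩ *
          ⟨(F.conn (x.act k))⁻¹ * l * F.conn (x.act (k * l)), mem_stab hy hj hl⟩ :
            D.stab ρ.base) =
          ⟨(F.conn x)⁻¹ * (k * l) * F.conn (x.act (k * l)), mem_stab hi hj rfl⟩ := by
        apply Subtype.ext
        simp [mul_assoc]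
      rw [hz] at hm
      have hp := congrArg (fun t : Circle => (t : ℂ)) (D.phase_mul (o := ρ.base) (x := x)
        (p := F.conn x) (q := F.conn (x.act k)) (r := F.conn (x.act (k * l))) (k := k) (l := l)
        (act_conn' hi) (mem_stab hi hy rfl))
      simp only [Circle.coe_mul] at hp
      rw [← mul_assoc]
      refine Eq.trans ?_ ((congrArg (_ * ·) hm).trans
        ((mul_assoc _ _ _).symm.trans (congrArg (· * _) hp)))
      rw [Finset.mul_sum]
      exact Finset.sum_congr rfl fun q _ => by ring
  · rw [ρ.mat_idx_of_not h, mul_zero]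
    refine Finset.sum_eq_zero fun K _ => ?_
    obtain ⟨u, hu, q, rfl⟩ := ρ.exists_idx K
    by_cases h1 : x = i
    · rw [ρ.mat_idx_of_not (u := x.act k) fun h2 => h ⟨h1, by rw [Obj.act_mul, h2.2]⟩, mul_zero]
    · rw [ρ.mat_idx_of_not fun h2 => h1 h2.1, zero_mul]

theorem Label.sum_mat_one (ρ : F.Label) : ∑ x, ρ.mat x 1 = 1 := by
  ext I J
  obtain ⟨x, hx, m, rfl⟩ := ρ.exists_idx I
  obtain ⟨y, hy, n, rfl⟩ := ρ.exists_idx J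
  rw [Matrix.sum_apply, Finset.sum_eq_single x]
  · by_cases h : x = y
    · subst h
      rw [ρ.mat_idx hx hx m n (Obj.act_one _)]
      have h1 : (⟨(F.conn x)⁻¹ * 1 * F.conn x,
          mem_stab hx hx (Obj.act_one _)⟩ : D.stab ρ.base) = 1 := by
        apply Subtype.ext
        simp
      rw [h1, ρ.rep.mat_one ρ.stabCocycle_one_one, D.phase_one, Circle.coe_one, one_mul,
        Matrix.one_apply, Matrix.one_apply]
      simp only [ρ.idx_inj, true_and]
    · rw [ρ.mat_idx_of_not fun h2 => h ((Obj.act_one _).symm.trans h2.2),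
        Matrix.one_apply_ne fun h2 => h (ρ.idx_inj.mp h2).1]
  · intro u _ hu
    rw [ρ.mat_idx_of_not fun h2 => hu h2.1]
  · simp

/-- The entry vanishes except on morphisms from `x` to `y`, and these are enumerated by the
stabiliser. Both orthogonality and separation are reduced to the stabiliser this way. -/
theorem Label.sum_mul_mat (ρ : F.Label) (g : D.Obj → D.K → ℂ) {x y : D.Obj} (hx : x.orbit = ρ.1)
    (hy : y.orbit = ρ.1) (m n : Fin ρ.rep.dim) :
    ∑ u, ∑ k, g u k * ρ.mat u k (ρ.idx x hx m) (ρ.idx y hy n) =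
      ∑ z : D.stab ρ.base, g x (F.conn x * z * (F.conn y)⁻¹) *
        ((D.phase ρ.base (F.conn x) (F.conn y) (F.conn x * z * (F.conn y)⁻¹) : ℂ) *
          ρ.rep.mat z m n) := by
  rw [Finset.sum_eq_single x]
  · symm
    refine Finset.sum_of_injOn (fun z => F.conn x * z * (F.conn y)⁻¹) ?_ (by simp) ?_ ?_
    · intro z _ w _ hzw
      simpa using hzw
    · intro k _ hk
      rw [ρ.mat_idx_of_not, mul_zero]
      intro h
      refine hk ⟨⟨(F.conn x)⁻¹ * k * F.conn y, mem_stab hx hy h.2⟩, by simp, ?_⟩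
      simp [mul_assoc]
    · intro z _
      rw [ρ.mat_idx_conn]
  · intro u _ hu
    refine Finset.sum_eq_zero fun k _ => ?_
    rw [ρ.mat_idx_of_not fun h2 => hu h2.1, mul_zero]
  · simp

/-- The phase depends on the orbit and the connecting morphisms but not on the class `R`, so it
cancels against its conjugate. -/
theorem sum_conj_mat_mul_mat_of_eq {O : D.Orbit}
    (R R' : IrrClass (D.stab (F.base O)) (D.stabCocycle (F.base O)))
    {x y : D.Obj} (hx : x.orbit = O) (hy : y.orbit = O) (m n : Fin (F.rep O R).dim)
    (m' n' : Fin (F.rep O R').dim) :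
    ∑ u : D.Obj, ∑ k : D.K, conj (Label.mat (F := F) ⟨O, R⟩ u k (Label.idx ⟨O, R⟩ x hx m)
          (Label.idx ⟨O, R⟩ y hy n)) *
        Label.mat (F := F) ⟨O, R'⟩ u k (Label.idx ⟨O, R'⟩ x hx m')
          (Label.idx ⟨O, R'⟩ y hy n') =
      ∑ z, conj ((F.rep O R).mat z m n) * (F.rep O R').mat z m' n' := by
  refine (Label.sum_mul_mat ⟨O, R'⟩ (fun u k => conj (Label.mat (F := F) ⟨O, R⟩ u k
    (Label.idx ⟨O, R⟩ x hx m) (Label.idx ⟨O, R⟩ y hy n))) hx hy m' n').trans ?_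
  refine Finset.sum_congr rfl fun z _ => ?_
  refine (congrArg (fun t => conj t * _)
    (Label.mat_idx_conn (F := F) ⟨O, R⟩ hx hy m n z)).trans ?_
  rw [map_mul]
  change conj (D.phase (F.base O) (F.conn x) (F.conn y) (F.conn x * z * (F.conn y)⁻¹) : ℂ) *
    conj ((F.rep O R).mat z m n) * ((D.phase (F.base O) (F.conn x) (F.conn y)
      (F.conn x * z * (F.conn y)⁻¹) : ℂ) * (F.rep O R').mat z m' n') = _
  linear_combination (conj ((F.rep O R).mat z m n) * (F.rep O R').mat z m' n') *
    Circle.conj_mul_self (D.phase (F.base O) (F.conn x) (F.conn y) (F.conn x * z * (F.conn y)⁻¹))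

theorem Label.sum_conj_mat_mul_mat_of_ne (ρ ρ' : F.Label) {x y x' y' : D.Obj}
    (hx : x.orbit = ρ.1) (hy : y.orbit = ρ.1) (hx' : x'.orbit = ρ'.1) (hy' : y'.orbit = ρ'.1)
    (m n : Fin ρ.rep.dim) (m' n' : Fin ρ'.rep.dim) (h : ¬ (x = x' ∧ y = y')) :
    ∑ u : D.Obj, ∑ k : D.K, conj (ρ.mat u k (ρ.idx x hx m) (ρ.idx y hy n)) *
        ρ'.mat u k (ρ'.idx x' hx' m') (ρ'.idx y' hy' n') = 0 := by
  refine Finset.sum_eq_zero fun u _ => Finset.sum_eq_zero fun k _ => ?_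
  by_cases hu : u = x ∧ u.act k = y
  · rw [ρ'.mat_idx_of_not, mul_zero]
    exact fun h2 => h ⟨hu.1.symm.trans h2.1, hu.2.symm.trans h2.2⟩
  · rw [ρ.mat_idx_of_not hu, map_zero, zero_mul]

theorem Label.dim_ne_zero (ρ : F.Label) : (ρ.dim : ℂ) ≠ 0 := by
  have : Nonempty {x : D.Obj // x.orbit = ρ.1} := ⟨⟨F.base ρ.1, F.orbit_base _⟩⟩
  exact Nat.cast_ne_zero.mpr (Nat.mul_pos Nat.card_pos ρ.rep.dim_pos).ne'

open Classical in
theorem Label.orthogonality (ρ : F.Label) (I J I' J' : ρ.Idx) :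
    1 / ((Nat.card D.A : ℂ) * Nat.card D.B) *
        ∑ x : D.Obj, ∑ k : D.K, conj (ρ.mat x k I J) * ρ.mat x k I' J' =
      if I = I' ∧ J = J' then 1 / (ρ.dim : ℂ) else 0 := by
  obtain ⟨x, hx, m, rfl⟩ := ρ.exists_idx I
  obtain ⟨y, hy, n, rfl⟩ := ρ.exists_idx J
  obtain ⟨x', hx', m', rfl⟩ := ρ.exists_idx I'
  obtain ⟨y', hy', n', rfl⟩ := ρ.exists_idx J'
  obtain ⟨O, R⟩ := ρ
  by_cases h : x = x' ∧ y = y'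
  · obtain ⟨rfl, rfl⟩ := h
    have h1 := (sum_conj_mat_mul_mat_of_eq R R hx hy m n m' n').trans
      ((F.rep O R).sum_conj_mul m n m' n')
    by_cases h' : m = m' ∧ n = n'
    · obtain ⟨rfl, rfl⟩ := h'
      refine (congrArg _ (h1.trans (if_pos ⟨rfl, rfl⟩))).trans ?_
      rw [if_pos ⟨rfl, rfl⟩]
      -- By orbit–stabiliser `|A||B| = |O||Z|`, which turns `|Z| / dim V_R` into `1 / d_ρ` after
      -- normalisation.
      have hc := congrArg (Nat.cast (R := ℂ)) (F.card_eq_mul_card_stab O)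
      have hd := Label.dim_ne_zero (F := F) ⟨O, R⟩
      change ((Nat.card {x : D.Obj // x.orbit = O} * (F.rep O R).dim : ℕ) : ℂ) ≠ 0 at hd
      change _ = 1 / ((Nat.card {x : D.Obj // x.orbit = O} * (F.rep O R).dim : ℕ) : ℂ)
      rw [Nat.cast_mul, Nat.cast_mul] at hc
      rw [hc]
      push_cast at hd ⊢
      have h2 : (Fintype.card (D.stab (F.base O)) : ℂ) ≠ 0 :=
        Nat.cast_ne_zero.mpr Fintype.card_ne_zero
      have h3 := left_ne_zero_of_mul hd
      have h4 := right_ne_zero_of_mul hd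
      field_simp
    · refine (congrArg _ (h1.trans (if_neg h'))).trans ?_
      rw [mul_zero, if_neg]
      exact fun h2 => h' ⟨((Label.idx_inj _).mp h2.1).2, ((Label.idx_inj _).mp h2.2).2⟩
  · rw [Label.sum_conj_mat_mul_mat_of_ne _ _ hx hy hx' hy' m n m' n' h, mul_zero, if_neg]
    exact fun h2 => h ⟨((Label.idx_inj _).mp h2.1).1, ((Label.idx_inj _).mp h2.2).1⟩

theorem Label.orthogonality_of_ne {ρ ρ' : F.Label} (h : ρ ≠ ρ') (I J : ρ.Idx) (I' J' : ρ'.Idx) :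
    1 / ((Nat.card D.A : ℂ) * Nat.card D.B) *
        ∑ x : D.Obj, ∑ k : D.K, conj (ρ.mat x k I J) * ρ'.mat x k I' J' = 0 := by
  obtain ⟨x, hx, m, rfl⟩ := ρ.exists_idx I
  obtain ⟨y, hy, n, rfl⟩ := ρ.exists_idx J
  obtain ⟨x', hx', m', rfl⟩ := ρ'.exists_idx I'
  obtain ⟨y', hy', n', rfl⟩ := ρ'.exists_idx J'
  by_cases hxy : x = x' ∧ y = y'
  · obtain ⟨rfl, rfl⟩ := hxy
    obtain ⟨O, R⟩ := ρ
    obtain ⟨O', R'⟩ := ρ'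
    -- A shared source forces the orbits to agree, so distinct labels must differ in the class.
    obtain rfl : O = O' := hx.symm.trans hx'
    have hR : R ≠ R' := fun e => h (by rw [e])
    exact (congrArg _ ((sum_conj_mat_mul_mat_of_eq R R' hx hy m n m' n').trans
      (SimpleProjRep.sum_conj_mul_of_not_equiv _ _ (fun e => hR (rep_eq_of_equiv e))
        m n m' n'))).trans (mul_zero _)
  · rw [ρ.sum_conj_mat_mul_mat_of_ne ρ' hx hy hx' hy' m n m' n' hxy, mul_zero]

/-- The matrices of all labels separate functions on morphisms. -/
theorem eq_zero_of_forall_sum_mul_mat (g : D.Obj → D.K → ℂ)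
    (hg : ∀ (ρ : F.Label) (I J : ρ.Idx), ∑ x, ∑ k, g x k * ρ.mat x k I J = 0) : g = 0 := by
  funext x k
  have hy : (x.act k).orbit = x.orbit := D.orbit_act x k
  -- On the morphisms from `x` to `x.act k`, the function `g` times the phase becomes a function on
  -- the stabiliser. It is annihilated by the chosen representatives, hence by all simple unitary
  -- representations.
  have key := eq_zero_of_forall_sum_smul_mat (c := D.stabCocycle (F.base x.orbit))
    (D.stabCocycle_cocycle _) (D.stabCocycle_one_left _)
    (fun z => g x (F.conn x * z * (F.conn (x.act k))⁻¹) *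
      D.phase (F.base x.orbit) (F.conn x) (F.conn (x.act k))
        (F.conn x * z * (F.conn (x.act k))⁻¹)) (fun S => by
      refine SimpleProjRep.sum_smul_mat_eq_zero_of_equiv
        (Quotient.exact (F.rep_mem x.orbit (Quotient.mk _ S))) _ ?_
      ext m n
      have h := (Label.sum_mul_mat ⟨x.orbit, Quotient.mk _ S⟩ g rfl hy m n).symm.trans
        (hg ⟨x.orbit, Quotient.mk _ S⟩ (Label.idx _ x rfl m) (Label.idx _ (x.act k) hy n))
      rw [Matrix.sum_apply]
      simp only [Matrix.smul_apply, smul_eq_mul, mul_assoc] at h ⊢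
      exact h)
  have hk := congrFun key ⟨(F.conn x)⁻¹ * k * F.conn (x.act k), mem_stab rfl hy rfl⟩
  have e : F.conn x * ((F.conn x)⁻¹ * k * F.conn (x.act k)) * (F.conn (x.act k))⁻¹ = k := by group
  simp only [e, Pi.zero_apply] at hk
  exact (mul_eq_zero.mp hk).resolve_right (Circle.coe_ne_zero _)

end Frame

end BoundaryData

/-! ### Algebras with matrix units -/

/-- A family of matrix representations of an algebra that separates its elements, together with
elements that map to the matrix units of one member of the family and to zero elsewhere. -/
structure MatrixUnits {R ι : Type*} [Ring R] [Algebra ℂ R] {n : ι → Type*} [∀ i, Fintype (n i)]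
    [∀ i, DecidableEq (n i)] (Φ : ∀ i, R →ₐ[ℂ] Matrix (n i) (n i) ℂ) where
  unit : ∀ i, n i → n i → R
  map_unit : ∀ i I J, Φ i (unit i I J) = Matrix.single I J 1
  map_unit_of_ne : ∀ i j, i ≠ j → ∀ I J, Φ j (unit i I J) = 0
  eq_zero : ∀ a, (∀ i, Φ i a = 0) → a = 0

section

variable {R n : Type*} [Ring R] [Algebra ℂ R] [Fintype n] [DecidableEq n]

theorem ColModule.smul_def (Φ : R →ₐ[ℂ] Matrix n n ℂ) (x : R) (v : n → ℂ) :
    (x • (show ColModule Φ from v) : ColModule Φ) = Φ x *ᵥ v := rfl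

/-- The transposed representation of the opposite algebra. -/
def transposeRep (Φ : R →ₐ[ℂ] Matrix n n ℂ) : Rᵐᵒᵖ →ₐ[ℂ] Matrix n n ℂ :=
  (Matrix.transposeAlgEquiv n ℂ ℂ).symm.toAlgHom.comp Φ.op

theorem transposeRep_apply (Φ : R →ₐ[ℂ] Matrix n n ℂ) (x : Rᵐᵒᵖ) :
    transposeRep Φ x = (Φ x.unop)ᵀ := rfl

/-- Row vectors are the column vectors of the transposed representation. -/
def rowEquivCol (Φ : R →ₐ[ℂ] Matrix n n ℂ) : RowModule Φ ≃ₗ[Rᵐᵒᵖ] ColModule (transposeRep Φ) where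
  toFun v := v
  invFun v := v
  left_inv _ := rfl
  right_inv _ := rfl
  map_add' _ _ := rfl
  map_smul' x v := (Matrix.mulVec_transpose (Φ x.unop) v).symm

end

namespace MatrixUnits

variable {R ι : Type*} [Ring R] [Algebra ℂ R] {n : ι → Type*} [∀ i, Fintype (n i)]
  [∀ i, DecidableEq (n i)] {Φ : ∀ i, R →ₐ[ℂ] Matrix (n i) (n i) ℂ}

theorem ext (E : MatrixUnits Φ) {a b : R} (h : ∀ i, Φ i a = Φ i b) : a = b :=
  sub_eq_zero.mp (E.eq_zero _ fun i => by rw [map_sub, h, sub_self])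

/-- The matrix units of the opposite algebra. -/
def op (E : MatrixUnits Φ) : MatrixUnits fun i => transposeRep (Φ i) where
  unit i I J := MulOpposite.op (E.unit i J I)
  map_unit i I J := by
    rw [transposeRep_apply, MulOpposite.unop_op, E.map_unit, Matrix.transpose_single]
  map_unit_of_ne i j h I J := by
    rw [transposeRep_apply, MulOpposite.unop_op, E.map_unit_of_ne i j h, Matrix.transpose_zero]
  eq_zero a h := MulOpposite.unop_injective (E.eq_zero _ fun i =>
    Matrix.transpose_injective (h i))

/-- If `v I ≠ 0`, the combination `∑ J, (w J / v I) • e_{JI}` sends `v` to `w`, so every nonzero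
vector generates. -/
theorem isSimpleModule_colModule (E : MatrixUnits Φ) (i : ι) [Nonempty (n i)] :
    IsSimpleModule R (ColModule (Φ i)) := by
  rw [isSimpleModule_iff_toSpanSingleton_surjective]
  refine ⟨inferInstanceAs (Nontrivial (n i → ℂ)), fun v hv w => ?_⟩
  have key : ∀ (v w : n i → ℂ) (I : n i), v I ≠ 0 →
      (∑ J, (w J / v I) • Matrix.single J I (1 : ℂ)) *ᵥ v = w := by
    intro v w I hI
    funext K
    rw [Matrix.sum_mulVec, Finset.sum_apply, Finset.sum_eq_single K]
    · simp [Matrix.single_mulVec, hI]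
    · intro J _ hJ
      simp [Matrix.single_mulVec, Function.update_of_ne (Ne.symm hJ)]
    · simp
  obtain ⟨I, hI⟩ := Function.ne_iff.mp hv
  refine ⟨∑ J, ((w : n i → ℂ) J / (v : n i → ℂ) I) • E.unit i J I, ?_⟩
  rw [LinearMap.toSpanSingleton_apply]
  refine (ColModule.smul_def (Φ i) _ v).trans ?_
  simp only [map_sum, map_smul, E.map_unit]
  exact key v w I hI

/-- A diagonal unit of block `i` fixes a nonzero vector of the module `i` and annihilates every
other module of the family. -/
theorem eq_of_colModule_equiv (E : MatrixUnits Φ) (i j : ι) [Nonempty (n i)]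
    (f : ColModule (Φ i) ≃ₗ[R] ColModule (Φ j)) : i = j := by
  by_contra h
  obtain ⟨I⟩ := (inferInstance : Nonempty (n i))
  have h1 : E.unit i I I • (show ColModule (Φ i) from Pi.single I 1) =
      (show ColModule (Φ i) from Pi.single I 1) := by
    refine (ColModule.smul_def (Φ i) _ _).trans ?_
    rw [E.map_unit, Matrix.single_mulVec]
    simp only [Pi.single_eq_same, one_mul]
    rfl
  have h2 := f.map_smul (E.unit i I I) (show ColModule (Φ i) from Pi.single I 1)
  have h3 : ∀ v : ColModule (Φ j), E.unit i I I • v = 0 := fun v => by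
    refine (ColModule.smul_def (Φ j) _ _).trans ?_
    rw [E.map_unit_of_ne i j h]
    exact Matrix.zero_mulVec _
  rw [h1, h3, LinearEquiv.map_eq_zero_iff] at h2
  have h4 := congrFun (show (Pi.single I 1 : n i → ℂ) = 0 from h2) I
  simp at h4

/-- Fourier inversion: both sides have the same image in each representation. For the explicit units
below this becomes completeness. -/
theorem sum_smul_unit (E : MatrixUnits Φ) [Fintype ι] (a : R) :
    ∑ i, ∑ I, ∑ J, Φ i a I J • E.unit i I J = a := by
  refine E.ext fun j => ?_
  rw [map_sum, Finset.sum_eq_single j]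
  · simp only [map_sum, map_smul, E.map_unit, Matrix.smul_single, smul_eq_mul, mul_one]
    exact (Matrix.matrix_eq_sum_single (Φ j a)).symm
  · intro i _ hij
    simp only [map_sum, map_smul, E.map_unit_of_ne i j hij, smul_zero, Finset.sum_const_zero]
  · simp

/-- One diagonal unit from each block gives a linearly independent family in a finite-dimensional
algebra. -/
theorem finite_index (E : MatrixUnits Φ) [Module.Finite ℂ R] [∀ i, Nonempty (n i)] : Finite ι := by
  have I : ∀ i, n i := fun i => Classical.arbitrary _
  have h : LinearIndependent ℂ fun i => E.unit i (I i) (I i) := by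
    rw [linearIndependent_iff']
    intro s g hg i hi
    have h1 := congrFun (congrFun (congrArg (Φ i) hg) (I i)) (I i)
    rw [map_sum, map_zero, Matrix.sum_apply, Finset.sum_eq_single i] at h1
    · simpa [E.map_unit] using h1
    · intro j _ hji
      simp [E.map_unit_of_ne j i hji]
    · exact fun h => absurd hi h
  exact h.finite

/-- Column `I` of block `i` is a left ideal that is a copy of the column module; this yields the
linear maps from column modules into an arbitrary module. -/
theorem mul_sum_smul_unit (E : MatrixUnits Φ) (i : ι) (I : n i) (x : R) (w : n i → ℂ) :
    x * ∑ J, w J • E.unit i J I = ∑ J, (Φ i x *ᵥ w) J • E.unit i J I := by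
  have h : ∀ w : n i → ℂ, ∑ J, w J • Matrix.single J I (1 : ℂ) =
      Matrix.vecMulVec w (Pi.single I 1) := by
    intro w
    ext a b
    rw [Matrix.sum_apply, Finset.sum_eq_single a]
    · by_cases hb : b = I
      · subst hb; simp [Matrix.vecMulVec_apply]
      · simp [Matrix.vecMulVec_apply, Matrix.single, hb, Ne.symm hb]
    · intro b _ hb
      simp [Matrix.single, hb]
    · simp
  refine E.ext fun j => ?_
  by_cases hij : i = j
  · subst hij
    simp only [map_mul, map_sum, map_smul, E.map_unit, h, Matrix.mul_vecMulVec]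
  · simp only [map_mul, map_sum, map_smul, E.map_unit_of_ne i j hij, smul_zero,
      Finset.sum_const_zero, mul_zero]

/-- The diagonal units sum to `1`, so some `e_{II}` does not annihilate a given `m ≠ 0`. Then `w ↦
(∑ J, w J • e_{JI}) • m` is a nonzero map between simple modules, hence bijective. -/
theorem exists_equiv_colModule (E : MatrixUnits Φ) [Fintype ι] [∀ i, Nonempty (n i)]
    (M : Type*) [AddCommGroup M]
    [Module R M] [IsSimpleModule R M] : ∃ i, Nonempty (M ≃ₗ[R] ColModule (Φ i)) := by
  have := IsSimpleModule.nontrivial R M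
  obtain ⟨m, hm⟩ := exists_ne (0 : M)
  obtain ⟨i, I, hI⟩ : ∃ i I, E.unit i I I • m ≠ 0 := by
    by_contra! h
    refine hm ?_
    rw [← one_smul R m, ← E.sum_smul_unit 1]
    simp only [map_one, Finset.sum_smul]
    refine Finset.sum_eq_zero fun i _ => Finset.sum_eq_zero fun I _ =>
      Finset.sum_eq_zero fun J _ => ?_
    by_cases hIJ : I = J
    · subst hIJ
      rw [Matrix.one_apply_eq, one_smul, h]
    · rw [Matrix.one_apply_ne hIJ, zero_smul, zero_smul]
  let g : ColModule (Φ i) →ₗ[R] M :=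
    { toFun := fun w => (∑ J, (w : n i → ℂ) J • E.unit i J I) • m
      map_add' := fun v w => by
        rw [← add_smul, ← Finset.sum_add_distrib]
        congr 1
        exact Finset.sum_congr rfl fun J _ => add_smul _ _ _
      map_smul' := fun x w => by
        rw [RingHom.id_apply, smul_smul]
        exact congrArg (· • m) (E.mul_sum_smul_unit i I x w).symm }
  have hg : g ≠ 0 := by
    intro h
    refine hI ?_
    have h1 := LinearMap.congr_fun h (show ColModule (Φ i) from Pi.single I 1)
    change (∑ J, (Pi.single I 1 : n i → ℂ) J • E.unit i J I) • m = 0 at h1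
    rwa [Finset.sum_eq_single I (fun J _ hJ => by rw [Pi.single_eq_of_ne hJ, zero_smul])
      (by simp), Pi.single_eq_same, one_smul] at h1
  have := E.isSimpleModule_colModule i
  exact ⟨i, ⟨(LinearEquiv.ofBijective g (LinearMap.bijective_of_ne_zero hg)).symm⟩⟩

theorem existsUnique_equiv_colModule (E : MatrixUnits Φ) [Fintype ι] [∀ i, Nonempty (n i)]
    (M : Type*)
    [AddCommGroup M] [Module R M] [IsSimpleModule R M] :
    ∃! i, Nonempty (M ≃ₗ[R] ColModule (Φ i)) := by
  obtain ⟨i, ⟨f⟩⟩ := E.exists_equiv_colModule M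
  exact ⟨i, ⟨f⟩, fun j ⟨g⟩ => E.eq_of_colModule_equiv j i (g.symm.trans f)⟩

theorem isSimpleModule_rowModule (E : MatrixUnits Φ) (i : ι) [Nonempty (n i)] :
    IsSimpleModule Rᵐᵒᵖ (RowModule (Φ i)) :=
  have := E.op.isSimpleModule_colModule i
  IsSimpleModule.congr (rowEquivCol (Φ i))

theorem eq_of_rowModule_equiv (E : MatrixUnits Φ) (i j : ι) [Nonempty (n i)]
    (f : RowModule (Φ i) ≃ₗ[Rᵐᵒᵖ] RowModule (Φ j)) : i = j :=
  E.op.eq_of_colModule_equiv i j (((rowEquivCol (Φ i)).symm.trans f).trans (rowEquivCol (Φ j)))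

theorem existsUnique_equiv_rowModule (E : MatrixUnits Φ) [Fintype ι] [∀ i, Nonempty (n i)]
    (M : Type*)
    [AddCommGroup M] [Module Rᵐᵒᵖ M] [IsSimpleModule Rᵐᵒᵖ M] :
    ∃! i, Nonempty (M ≃ₗ[Rᵐᵒᵖ] RowModule (Φ i)) := by
  obtain ⟨i, ⟨f⟩⟩ := E.op.exists_equiv_colModule M
  exact ⟨i, ⟨f.trans (rowEquivCol (Φ i)).symm⟩, fun j ⟨g⟩ =>
    E.op.eq_of_colModule_equiv j i ((g.trans (rowEquivCol (Φ j))).symm.trans f)⟩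

/-- Separation gives injectivity and the units give surjectivity of the map to the finite product of
matrix algebras. -/
theorem isSemisimpleRing (E : MatrixUnits Φ) [Fintype ι] : IsSemisimpleRing R := by
  let f : R →+* ∀ i, Matrix (n i) (n i) ℂ := RingHom.pi fun i => (Φ i).toRingHom
  have hf : Function.Bijective f := by
    refine ⟨fun a b h => E.ext fun i => congrFun h i, fun M => ?_⟩
    refine ⟨∑ i, ∑ I, ∑ J, M i I J • E.unit i I J, ?_⟩
    funext j
    change Φ j _ = _
    rw [map_sum, Finset.sum_eq_single j]
    · simp only [map_sum, map_smul, E.map_unit, Matrix.smul_single, smul_eq_mul, mul_one]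
      exact (Matrix.matrix_eq_sum_single (M j)).symm
    · intro i _ hij
      simp only [map_sum, map_smul, E.map_unit_of_ne i j hij, smul_zero, Finset.sum_const_zero]
    · simp
  exact (RingEquiv.ofBijective f hf).symm.isSemisimpleRing

end MatrixUnits

namespace BoundaryData

variable {G : Type*} [Group G] (D : BoundaryData G)

/-! ### The star operation and the coefficients -/

theorem alg_induction {P : D.Alg → Prop} (a : D.Alg) (zero : P 0)
    (hadd : ∀ a b, P a → P b → P (a + b)) (smul_ket : ∀ (c : ℂ) x k, P (c • D.ket x k)) : P a := by
  refine Finsupp.induction_linear a zero hadd fun u c => ?_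
  have h := smul_ket c u.1 u.2
  have e : c • D.ket u.1 u.2 = Finsupp.single u c := by
    refine (Finsupp.smul_single c u (1 : ℂ)).trans ?_
    rw [smul_eq_mul, mul_one]
  rwa [e] at h

/-- The coefficient of a basis element. -/
def coeff (x : D.Obj) (k : D.K) : D.Alg →ₗ[ℂ] ℂ := Finsupp.lapply (x, k)

open Classical in
theorem coeff_ket (x y : D.Obj) (k l : D.K) :
    D.coeff x k (D.ket y l) = if x = y ∧ k = l then 1 else 0 := by
  refine (Finsupp.single_apply).trans ?_
  simp only [Prod.mk.injEq, eq_comm]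

variable [Finite G]

theorem sum_coeff_smul_ket (a : D.Alg) : ∑ x, ∑ k, D.coeff x k a • D.ket x k = a := by
  classical
  have h : ∑ x, ∑ k, (D.coeff x k).smulRight (D.ket x k) = LinearMap.id := by
    apply D.hom_ext
    intro y l
    simp only [LinearMap.sum_apply, LinearMap.smulRight_apply, coeff_ket, LinearMap.id_apply]
    rw [Finset.sum_eq_single y, Finset.sum_eq_single l] <;> simp +contextual
  simpa using LinearMap.congr_fun h a

theorem star_add_alg (a b : D.Alg) : star (a + b) = star a + star b := by
  refine Finsupp.sum_add_index' (fun u => ?_) fun u c d => ?_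
  · rw [map_zero, zero_mul, zero_smul]
  · rw [map_add, add_mul, add_smul]

theorem star_smul_alg (c : ℂ) (a : D.Alg) : star (c • a) = conj c • star a := by
  refine (Finsupp.sum_smul_index (fun u => ?_)).trans ?_
  · rw [map_zero, zero_mul, zero_smul]
  · refine Eq.trans ?_ Finsupp.smul_sum.symm
    refine Finsupp.sum_congr fun u _ => ?_
    rw [map_mul, mul_assoc, mul_smul]

theorem star_ket (x : D.Obj) (k : D.K) :
    star (D.ket x k) = (D.theta x k k⁻¹ : ℂ)⁻¹ • D.ket (x.act k) k⁻¹ := by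
  refine (Finsupp.sum_single_index ?_).trans ?_
  · rw [map_zero, zero_mul, zero_smul]
  · rw [map_one, one_mul, Circle.coe_inv]

instance : Module.Finite ℂ D.Alg := inferInstanceAs (Module.Finite ℂ ((D.Obj × D.K) →₀ ℂ))

/-! ### The label representations, their matrix units and completeness -/

namespace Frame

variable {D} {F : D.Frame}

instance (ρ : F.Label) : Nonempty ρ.Idx :=
  ⟨ρ.idx _ (F.orbit_base ρ.1) ⟨0, ρ.rep.dim_pos⟩⟩

/-- The representation of the twisted relative groupoid algebra with matrices `ρ.mat`. -/
def Label.toAlgHom (ρ : F.Label) : D.Alg →ₐ[ℂ] Matrix ρ.Idx ρ.Idx ℂ :=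
  AlgHom.ofLinearMap (D.extend fun u => ρ.mat u.1 u.2)
    (by simp only [one_def, map_sum, extend_ket, ρ.sum_mat_one])
    (by
      classical
      intro a b
      induction a using D.alg_induction with
      | zero => rw [zero_mul, map_zero, zero_mul]
      | hadd a a' h h' => rw [add_mul, map_add, map_add, add_mul, h, h']
      | smul_ket c x k =>
        induction b using D.alg_induction with
        | zero => rw [mul_zero, map_zero, mul_zero]
        | hadd b b' h h' => rw [mul_add, map_add, map_add, mul_add, h, h']
        | smul_ket d y l =>
          rw [smul_mul_smul_comm, map_smul, map_smul, map_smul, smul_mul_smul_comm, ket_mul_ket]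
          congr 1
          split_ifs with h
          · subst h
            rw [map_smul, extend_ket, extend_ket, extend_ket, ρ.mat_mul_mat]
          · rw [map_zero, extend_ket, extend_ket, ρ.mat_mul_mat_of_ne h])

theorem Label.toAlgHom_ket (ρ : F.Label) (x : D.Obj) (k : D.K) :
    ρ.toAlgHom (D.ket x k) = ρ.mat x k :=
  D.extend_ket _ x k

theorem Label.toAlgHom_apply (ρ : F.Label) (a : D.Alg) (I J : ρ.Idx) :
    ρ.toAlgHom a I J = ∑ x, ∑ k, D.coeff x k a * ρ.mat x k I J := by
  conv_lhs => rw [← D.sum_coeff_smul_ket a]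
  simp only [map_sum, map_smul, toAlgHom_ket, Matrix.sum_apply, Matrix.smul_apply, smul_eq_mul]

theorem eq_zero_of_forall_toAlgHom (a : D.Alg) (h : ∀ ρ : F.Label, ρ.toAlgHom a = 0) : a = 0 := by
  have h1 := eq_zero_of_forall_sum_mul_mat (F := F) (fun x k => D.coeff x k a) fun ρ I J => by
    rw [← ρ.toAlgHom_apply, h, Matrix.zero_apply]
  rw [← D.sum_coeff_smul_ket a]
  refine Finset.sum_eq_zero fun x _ => Finset.sum_eq_zero fun k _ => ?_
  rw [show D.coeff x k a = 0 from congrFun (congrFun h1 x) k, zero_smul]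

theorem Label.toAlgHom_star (ρ : F.Label) (a : D.Alg) :
    ρ.toAlgHom (star a) = (ρ.toAlgHom a)ᴴ := by
  induction a using D.alg_induction with
  | zero =>
    have h : star (0 : D.Alg) = 0 := by simpa using D.star_smul_alg 0 0
    rw [h, map_zero, Matrix.conjTranspose_zero]
  | hadd a b h h' => rw [star_add_alg, map_add, map_add, Matrix.conjTranspose_add, h, h']
  | smul_ket c x k =>
    rw [star_smul_alg, map_smul, map_smul, Matrix.conjTranspose_smul, star_ket, map_smul,
      toAlgHom_ket, toAlgHom_ket]
    congr 1
    ext I J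
    rw [Matrix.conjTranspose_apply, Complex.star_def, ρ.conj_mat, Matrix.smul_apply, smul_eq_mul]

/-- The matrix units of the twisted relative groupoid algebra. -/
def matrixUnits (F : D.Frame) : MatrixUnits fun ρ : F.Label => ρ.toAlgHom where
  -- The conjugate entries make the image of this element an orthogonality sum, and the factor `d_ρ`
  -- cancels the `1 / d_ρ` in it.
  unit ρ I J := ∑ x, ∑ k, ((ρ.dim : ℂ) * (1 / ((Nat.card D.A : ℂ) * Nat.card D.B)) *
    conj (ρ.mat x k I J)) • D.ket x k
  map_unit ρ I J := by
    classical
    ext I' J'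
    simp only [map_sum, map_smul, Label.toAlgHom_ket, Matrix.sum_apply, Matrix.smul_apply,
      smul_eq_mul, mul_assoc, ← Finset.mul_sum]
    rw [ρ.orthogonality, Matrix.single_apply]
    split_ifs
    · exact mul_one_div_cancel ρ.dim_ne_zero
    · exact mul_zero _
  map_unit_of_ne ρ ρ' h I J := by
    ext I' J'
    simp only [map_sum, map_smul, Label.toAlgHom_ket, Matrix.sum_apply, Matrix.smul_apply,
      smul_eq_mul, mul_assoc, ← Finset.mul_sum]
    rw [Label.orthogonality_of_ne h, mul_zero, Matrix.zero_apply]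
  eq_zero := eq_zero_of_forall_toAlgHom

open Classical in
theorem coeff_matrixUnits_unit (ρ : F.Label) (I J : ρ.Idx) (x : D.Obj) (k : D.K) :
    D.coeff x k (F.matrixUnits.unit ρ I J) =
      (ρ.dim : ℂ) * (1 / ((Nat.card D.A : ℂ) * Nat.card D.B)) * conj (ρ.mat x k I J) := by
  change D.coeff x k (∑ y, ∑ l, _) = _
  simp only [map_sum, map_smul, coeff_ket, smul_eq_mul]
  rw [Finset.sum_eq_single x, Finset.sum_eq_single k] <;> simp +contextual [eq_comm]

-- The coefficient at `(x', k')` is compared on both sides of the expansion of `|x, k⟩` in matrix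
-- units.
open Classical in
theorem completeness [Fintype F.Label] (x x' : D.Obj) (k k' : D.K) :
    1 / ((Nat.card D.A : ℂ) * Nat.card D.B) *
        ∑ ρ : F.Label, ∑ I : ρ.Idx, ∑ J : ρ.Idx,
          (ρ.dim : ℂ) * ρ.mat x k I J * conj (ρ.mat x' k' I J) =
      if x = x' ∧ k = k' then 1 else 0 := by
  have h := congrArg (D.coeff x' k') (F.matrixUnits.sum_smul_unit (D.ket x k))
  rw [coeff_ket] at h
  simp only [map_sum, map_smul, coeff_matrixUnits_unit, Label.toAlgHom_ket, smul_eq_mul] at h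
  simp only [eq_comm (a := x), eq_comm (a := k)]
  rw [← h]
  simp only [Finset.mul_sum]
  refine Finset.sum_congr rfl fun ρ _ => Finset.sum_congr rfl fun I _ =>
    Finset.sum_congr rfl fun J _ => by ring

end Frame

end BoundaryData

end RelGpd

end

open Classical RelGpd BoundaryData in
theorem mainTheorem2 {G : Type*} [Group G] [Finite G] (D : BoundaryData G) (F : D.Frame) :
    -- the algebra is a `*`-algebra
    (∀ x : D.Alg, star (star x) = x) ∧
    (∀ x y : D.Alg, star (x * y) = star y * star x) ∧
    (∀ x y : D.Alg, star (x + y) = star x + star y) ∧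
    (∀ (c : ℂ) (x : D.Alg), star (c • x) = (starRingEnd ℂ c) • star x) ∧
    -- it is semisimple
    IsSemisimpleRing D.Alg ∧
    -- the explicit matrices define unital algebra homomorphisms
    ∃ Φ : ∀ ρ : F.Label, D.Alg →ₐ[ℂ] Matrix ρ.Idx ρ.Idx ℂ,
      (∀ (ρ : F.Label) (x : D.Obj) (k : D.K), Φ ρ (D.ket x k) = ρ.mat x k) ∧
      (∀ (ρ : F.Label) (x : D.Alg), Φ ρ (star x) = (Φ ρ x)ᴴ) ∧
      -- the modules of the labels `ρ = (O, R)` are simple and pairwise non-isomorphic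
      (∀ ρ : F.Label, IsSimpleModule D.Algᵐᵒᵖ (RowModule (Φ ρ))) ∧
      (∀ ρ : F.Label, IsSimpleModule D.Alg (ColModule (Φ ρ))) ∧
      (∀ ρ ρ' : F.Label, Nonempty (RowModule (Φ ρ) ≃ₗ[D.Algᵐᵒᵖ] RowModule (Φ ρ')) → ρ = ρ') ∧
      (∀ ρ ρ' : F.Label, Nonempty (ColModule (Φ ρ) ≃ₗ[D.Alg] ColModule (Φ ρ')) → ρ = ρ') ∧
      -- every simple (right, respectively left) module is one of them
      (∀ (M : Type*) [AddCommGroup M] [Module D.Algᵐᵒᵖ M] [IsSimpleModule D.Algᵐᵒᵖ M],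
        ∃! ρ : F.Label, Nonempty (M ≃ₗ[D.Algᵐᵒᵖ] RowModule (Φ ρ))) ∧
      (∀ (M : Type*) [AddCommGroup M] [Module D.Alg M] [IsSimpleModule D.Alg M],
        ∃! ρ : F.Label, Nonempty (M ≃ₗ[D.Alg] ColModule (Φ ρ))) ∧
      -- orthogonality
      (∀ (ρ : F.Label) (I J I' J' : ρ.Idx),
        1 / ((Nat.card D.A : ℂ) * Nat.card D.B) *
            ∑ x : D.Obj, ∑ k : D.K, starRingEnd ℂ (ρ.mat x k I J) * ρ.mat x k I' J' =
          if I = I' ∧ J = J' then 1 / (ρ.dim : ℂ) else 0) ∧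
      (∀ (ρ ρ' : F.Label), ρ ≠ ρ' → ∀ (I J : ρ.Idx) (I' J' : ρ'.Idx),
        1 / ((Nat.card D.A : ℂ) * Nat.card D.B) *
            ∑ x : D.Obj, ∑ k : D.K, starRingEnd ℂ (ρ.mat x k I J) * ρ'.mat x k I' J' = 0) ∧
      -- completeness
      ∃ _ : Fintype F.Label, ∀ (x x' : D.Obj) (k k' : D.K),
        1 / ((Nat.card D.A : ℂ) * Nat.card D.B) *
            ∑ ρ : F.Label, ∑ I : ρ.Idx, ∑ J : ρ.Idx,
              (ρ.dim : ℂ) * ρ.mat x k I J * starRingEnd ℂ (ρ.mat x' k' I J) =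
          if x = x' ∧ k = k' then 1 else 0 := by
  have E := F.matrixUnits
  have : Finite F.Label := E.finite_index
  have : Fintype F.Label := Fintype.ofFinite _
  refine ⟨fun x => E.ext fun ρ => ?_, fun x y => E.ext fun ρ => ?_, D.star_add_alg,
    D.star_smul_alg, E.isSemisimpleRing, fun ρ => ρ.toAlgHom, Frame.Label.toAlgHom_ket,
    Frame.Label.toAlgHom_star, fun ρ => E.isSimpleModule_rowModule ρ,
    fun ρ => E.isSimpleModule_colModule ρ, fun ρ ρ' ⟨f⟩ => E.eq_of_rowModule_equiv ρ ρ' f,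
    fun ρ ρ' ⟨f⟩ => E.eq_of_colModule_equiv ρ ρ' f, fun M _ _ _ => E.existsUnique_equiv_rowModule M,
    fun M _ _ _ => E.existsUnique_equiv_colModule M, Frame.Label.orthogonality,
    fun ρ ρ' h => Frame.Label.orthogonality_of_ne h, inferInstance, Frame.completeness⟩
  -- By joint faithfulness the star laws need checking only in each representation, where the star
  -- is the conjugate transpose.
  · rw [ρ.toAlgHom_star, ρ.toAlgHom_star, Matrix.conjTranspose_conjTranspose]
  · rw [ρ.toAlgHom_star, map_mul, map_mul, ρ.toAlgHom_star, ρ.toAlgHom_star,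
      Matrix.conjTranspose_mul]
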